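/- Let $p>2$, $\omega>0$, and let $\phi=\phi_{\omega,p}:\mathbb R\to[0,\infty)$ be the bell-shaped compacton, i.e. the even, continuous, nonnegative function, decreasing on $(0,\infty)$, positive exactly on an interval $(-L,L)$ with $0<L<\infty$, of class $C^2$ on $(-L,L)$ and with $\phi^2\in C^1(\mathbb R)$, which solves the profile equation $$-\phi\,\partial_x(\phi\,\partial_x\phi)+\omega\phi-|\phi|^{p-2}\phi=0 .$$ Consider the differential expressions $$\mathcal H_+ f=-\phi\,\partial_x^2(\phi f)+\bigl(\omega-(\phi\phi')'-(p-1)\phi^{p-2}\bigr)f,\qquad \mathcal H_- f=-\phi\,\partial_x^2(\phi f)+\bigl(\omega+(\phi\phi')'-\phi^{p-2}\bigr)f .$$ Let $\Omega=\mathbb R$ or $\Omega=(-L,L)$, and regard $\mathcal H_\pm$ as the symmetric operators in the complex Hilbert space $L^2(\Omega)$ with domain $C_c^\infty(\Omega)$ that are associated with the quadratic forms $$q_\pm(u,v)=\langle(\phi u)',(\phi v)'\rangle+\langle V_\pm u,v\rangle,\qquad V_+=\omega-(\phi\phi')'-(p-1)\phi^{p-2},\quad V_-=\omega+(\phi\phi')'-\phi^{p-2}.$$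 Then: 1. Every self-adjoint extension $A$ of $\mathcal H_-$ in $L^2(\Omega)$ satisfies $A\ge 0$; zero is a simple eigenvalue with $\mathrm{Ker}(A)=\mathrm{span}[\phi]$, and $\langle Au,u\rangle>0$ for every $u\in D(A)\setminus\{0\}$ with $u\perp\phi$. 2. Every self-adjoint extension $A$ of $\mathcal H_+$ in $L^2(\Omega)$ has exactly one negative eigenvalue, and it is simple; moreover $n(A)=1$, where $n(A)$ is the largest dimension of a subspace of $D(A)$ on which $u\mapsto\langle Au,u\rangle$ is negative definite. The second smallest eigenvalue of $A$ is zero, and it is simple, with $\mathrm{Ker}(A)=\mathrm{span}[\phi']$. -/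

import Mathlib

open MeasureTheory
open scoped ComplexConjugate

noncomputable section

namespace Compacton

/-- `φ` is a bell-shaped compacton with support `[-L, L]`: a bell-shaped (even, nonnegative,
decreasing on `(0, ∞)`) continuous function, positive exactly on `(-L, L)`, which solves the
profile equation `-φ ∂ₓ(φ ∂ₓ φ) + ω φ - |φ|^(p-2) φ = 0`.
The function `φ` itself is only Lipschitz at `± L`; the flux `φ ∂ₓ φ = ½ ∂ₓ(φ²)` that is
differentiated in the profile equation is required to be continuous on the whole line. -/
structure IsCompacton (p ω L : ℝ) (φ : ℝ → ℝ) : Prop where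
  L_pos : 0 < L
  continuous : Continuous φ
  even : ∀ x, φ (-x) = φ x
  nonneg : ∀ x, 0 ≤ φ x
  antitone : AntitoneOn φ (Set.Ioi 0)
  support_eq : Function.support φ = Set.Ioo (-L) L
  contDiffOn : ContDiffOn ℝ 2 φ (Set.Ioo (-L) L)
  contDiff_sq : ContDiff ℝ 1 (fun x => φ x ^ 2)
  profile : ∀ x, -φ x * deriv (fun y => φ y * deriv φ y) x + ω * φ x
    - |φ x| ^ (p - 2) * φ x = 0

/-- Zeroth-order coefficient of `H₊`: `ω - (φ φ')' - (p - 1) φ^(p-2)`. -/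
def potPlus (p ω : ℝ) (φ : ℝ → ℝ) (x : ℝ) : ℝ :=
  ω - deriv (fun y => φ y * deriv φ y) x - (p - 1) * φ x ^ (p - 2)

/-- Zeroth-order coefficient of `H₋`: `ω + (φ φ')' - φ^(p-2)`. -/
def potMinus (p ω : ℝ) (φ : ℝ → ℝ) (x : ℝ) : ℝ :=
  ω + deriv (fun y => φ y * deriv φ y) x - φ x ^ (p - 2)

/-- The complex Hilbert space `L²(Ω)`, with Lebesgue measure. -/
abbrev L2 (Ω : Set ℝ) : Type := Lp ℂ 2 (volume.restrict Ω)

/-- Test functions: `f ∈ C_c^∞(Ω)`. -/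
structure IsTest (Ω : Set ℝ) (f : ℝ → ℂ) : Prop where
  smooth : ContDiff ℝ (⊤ : ℕ∞) f
  compact : HasCompactSupport f
  subset : tsupport f ⊆ Ω

/-- The quadratic form `q(f, g) = ⟨(φ f)', (φ g)'⟩ + ⟨V f, g⟩`, antilinear in the second slot. -/
def form (φ V : ℝ → ℝ) (Ω : Set ℝ) (f g : ℝ → ℂ) : ℂ :=
  (∫ x in Ω, deriv (fun y => (φ y : ℂ) * f y) x * conj (deriv (fun y => (φ y : ℂ) * g y) x))
    + ∫ x in Ω, (V x : ℂ) * f x * conj (g x)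

/-- The graph of the symmetric operator `S` in `L²(Ω)` associated with the form `q` on
`C_c^∞(Ω)`: `S f = w` means `q(f, g) = ⟨w, g⟩` for all test functions `g`, that is,
`w = -φ ∂ₓ²(φ f) + V f`. -/
def symmGraph (φ V : ℝ → ℝ) (Ω : Set ℝ) : Set (L2 Ω × L2 Ω) :=
  {z | ∃ f : ℝ → ℂ, IsTest Ω f ∧ z.1 =ᵐ[volume.restrict Ω] f ∧
    ∀ g : ℝ → ℂ, IsTest Ω g → form φ V Ω f g = ∫ x in Ω, z.2 x * conj (g x)}

/-- `A` is a self-adjoint extension, in `L²(Ω)`, of the symmetric operator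
`f ↦ -φ ∂ₓ²(φ f) + V f` with domain `C_c^∞(Ω)`. -/
def IsSelfAdjointExtension (φ V : ℝ → ℝ) (Ω : Set ℝ) (A : L2 Ω →ₗ.[ℂ] L2 Ω) : Prop :=
  IsSelfAdjoint A ∧ symmGraph φ V Ω ⊆ A.graph

section Spectral

variable {E : Type*} [NormedAddCommGroup E] [InnerProductSpace ℂ E]

/-- The space `{u ∈ D(A) : A u = z u}`. -/
def eigenspace (A : E →ₗ.[ℂ] E) (z : ℂ) : Submodule ℂ E :=
  (LinearMap.ker (A.toFun - z • A.domain.subtype)).map A.domain.subtype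

/-- `A ≥ 0`. -/
def IsNonneg (A : E →ₗ.[ℂ] E) : Prop :=
  ∀ u : A.domain, 0 ≤ (inner ℂ (u : E) (A u)).re

/-- The form of `A` is negative definite on the subspace `V` of `D(A)`. -/
def IsNegativeSubspace (A : E →ₗ.[ℂ] E) (V : Submodule ℂ E) : Prop :=
  V ≤ A.domain ∧ ∀ u : A.domain, (u : E) ∈ V → u ≠ 0 → (inner ℂ (u : E) (A u)).re < 0

/-- The index `n(A)`: the supremum of the dimensions of the subspaces of `D(A)` on which `A` is
negative definite, that is, the number of negative eigenvalues counted with multiplicity when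
the negative spectrum is finite. -/
def negIndex (A : E →ₗ.[ℂ] E) : ℕ∞ :=
  ⨆ V : {V : Submodule ℂ E // IsNegativeSubspace A V}, Cardinal.toENat (Module.rank ℂ V.1)

end Spectral

end Compacton

end

/-! ### Abstract operator theory: cores, factorizations `D' D - m`, spectral gap. -/

namespace Compacton

section Abstract

open Filter Topology

variable {E : Type*} [NormedAddCommGroup E] [InnerProductSpace ℂ E]
  {T : Type*} [AddCommGroup T] [Module ℂ T]

/-! On (-L, L) the profile equation integrates to φ'² = ω - (2/p) φ^(p-2) (`sq_deriv`), hence φ φ''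
= -((p-2)/p) φ^(p-2) (`mul_deriv_deriv`). Let D_a = φ ∂ - a φ', which annihilates φ^a, with formal
adjoint D_a' = -φ ∂ - (a+1) φ'. The two identities give D_a' D_a f = -φ ∂²(φ f) + (a(a+1) ω -
((a+1)(2a+p-2)/p) φ^(p-2)) f. Both potentials have the form α + β φ^(p-2) on (-L, L), so each of the
two roots a of the quadratic equation for β (their sum is -p/2) yields a factorization H = D_a' D_a
- m with m = a(a+1) ω - α. Outside [-L, L] the operator is multiplication by ω, and D_a is continued
there as multiplication by c with c² = ω + m. The coefficients are smooth away from ± L, so test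
functions are taken on Ω without these two points.

The smaller root b ≤ -1, with shift l > m, shows that the choice of A is immaterial. An L² function
orthogonal to the range of H + l = D_b' D_b equals (k + d G) φ^b on (-L, L) with G bounded and
increasing; since φ vanishes at least linearly at ± L, square integrability kills both constants. As
also H + l ≥ l - m > 0, the test functions are a core of every self-adjoint extension
(`coreData_of_dense`, `coreData`).

The larger root describes the bottom of the spectrum: A + m ≥ 0, and its form vanishes only on the
line of φ^a. For H₋ this is a = 1, m = 0, which settles the first claim. For H₊ it is a = (p-2)/2, m
= ω p (p-2)/4, so -m is a simple eigenvalue. The reversed product is D D' = K' K + m with K = φ ∂ on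
(-L, L), so D' D has no spectrum strictly between 0 and m: A is nonnegative on the complement of the
ground state (`form_nonneg_of_inner_eq_zero`). At the edge of the gap, D maps the kernel of A into
the kernel of K, spanned by the indicator of (-L, L), and D' of that indicator is a multiple of φ'
(`eigenspace_zero_of_gap`). -/

lemma mem_eigenspace_iff {A : E →ₗ.[ℂ] E} {z : ℂ} {x : E} :
    x ∈ eigenspace A z ↔ (x, z • x) ∈ A.graph := by
  rw [eigenspace, Submodule.mem_map, LinearPMap.mem_graph_iff]
  constructor
  · rintro ⟨y, hy, rfl⟩
    refine ⟨y, rfl, ?_⟩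
    have : A.toFun y - z • (y : E) = 0 := hy
    exact sub_eq_zero.1 this
  · rintro ⟨y, hy, hz⟩
    refine ⟨y, ?_, hy⟩
    have hz' : A.toFun y = z • x := hz
    simp only at hy
    simp [LinearMap.mem_ker, hz', hy]

/-- `D'` is a formal adjoint of `D` on test vectors, embedded in a Hilbert space by `J`. -/
def FormalAdjointOn (J : T →ₗ[ℂ] E) (D D' : T →ₗ[ℂ] T) : Prop :=
  ∀ f g, inner ℂ (J (D f)) (J g) = inner ℂ (J f) (J (D' g))

lemma FormalAdjointOn.symm {J : T →ₗ[ℂ] E} {D D' : T →ₗ[ℂ] T} (h : FormalAdjointOn J D D') :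
    FormalAdjointOn J D' D := fun f g => by
  rw [← inner_conj_symm, ← h, inner_conj_symm]

lemma FormalAdjointOn.inner_self {J : T →ₗ[ℂ] E} {D D' : T →ₗ[ℂ] T} (h : FormalAdjointOn J D D')
    (f : T) : (inner ℂ (J f) (J (D' (D f)))).re = ‖J (D f)‖ ^ 2 := by
  rw [← h, inner_self_eq_norm_sq_to_K]
  norm_cast

variable [CompleteSpace E] {A : E →ₗ.[ℂ] E}

lemma symmetric_of_isSelfAdjoint (hA : IsSelfAdjoint A) {x x' y y' : E}
    (hx : (x, x') ∈ A.graph) (hy : (y, y') ∈ A.graph) :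
    inner ℂ x' y = inner ℂ x y' := by
  have h := A.adjoint_isFormalAdjoint hA.dense_domain
  rw [LinearPMap.isSelfAdjoint_def.1 hA] at h
  rw [LinearPMap.mem_graph_iff] at hx hy
  obtain ⟨u, rfl, rfl⟩ := hx
  obtain ⟨v, rfl, rfl⟩ := hy
  exact h u v

lemma mem_graph_of_forall_inner (hA : IsSelfAdjoint A) {x x' : E}
    (h : ∀ y y', (y, y') ∈ A.graph → inner ℂ x' y = inner ℂ x y') : (x, x') ∈ A.graph := by
  have h' : ∀ u : A.domain, inner ℂ x' (u : E) = inner ℂ x (A u) :=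
    fun u => h _ _ (A.mem_graph u)
  have hx : x ∈ (A.adjoint).domain := A.mem_adjoint_domain_of_exists x ⟨x', h'⟩
  have := LinearPMap.adjoint_apply_eq hA.dense_domain ⟨x, hx⟩ h'
  have hm : (x, x') ∈ (A.adjoint).graph := this ▸ (A.adjoint).mem_graph ⟨x, hx⟩
  rwa [LinearPMap.isSelfAdjoint_def.1 hA] at hm

/-- `A` is self-adjoint, extends the operator `H` on test vectors, and has the test vectors as a
core. -/
structure CoreData (J : T →ₗ[ℂ] E) (H : T →ₗ[ℂ] T) (A : E →ₗ.[ℂ] E) : Prop where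
  selfAdjoint : IsSelfAdjoint A
  graph : ∀ f, (J f, J (H f)) ∈ A.graph
  core : ∀ x x', (x, x') ∈ A.graph → ∃ g : ℕ → T,
    Tendsto (fun n => J (g n)) atTop (𝓝 x) ∧ Tendsto (fun n => J (H (g n))) atTop (𝓝 x')

/-- If `H + b` is bounded below by `ε > 0` and has dense range, then the test vectors form a core of
every self-adjoint extension of `H`. -/
theorem coreData_of_dense {J : T →ₗ[ℂ] E} {H : T →ₗ[ℂ] T} (hA : IsSelfAdjoint A)
    (hgraph : ∀ f, (J f, J (H f)) ∈ A.graph) {b ε : ℝ} (hε : 0 < ε)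
    (hlow : ∀ f, ε * ‖J f‖ ^ 2 ≤ (inner ℂ (J f) (J (H f + (b : ℂ) • f))).re)
    (hdense : ∀ x : E, (∀ f, inner ℂ x (J (H f + (b : ℂ) • f)) = 0) → x = 0) :
    CoreData J H A := by
  refine ⟨hA, hgraph, fun x x' hx => ?_⟩
  set S : T →ₗ[ℂ] E := J ∘ₗ (H + (b : ℂ) • LinearMap.id) with hS
  have hSf : ∀ f, S f = J (H f + (b : ℂ) • f) := fun f => rfl
  have hbd : ∀ f, ‖J f‖ ≤ ε⁻¹ * ‖S f‖ := by
    intro f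
    have h1 := hlow f
    rw [← hSf] at h1
    have h2 : (inner ℂ (J f) (S f)).re ≤ ‖J f‖ * ‖S f‖ :=
      (Complex.re_le_norm _).trans (norm_inner_le_norm _ _)
    rw [le_inv_mul_iff₀ hε]
    by_cases h0 : ‖J f‖ = 0
    · rw [h0]; simp
    · have : 0 < ‖J f‖ := lt_of_le_of_ne (norm_nonneg _) (Ne.symm h0)
      nlinarith
  have hrange : (LinearMap.range S).topologicalClosure = ⊤ := by
    rw [Submodule.topologicalClosure_eq_top_iff, Submodule.eq_bot_iff]
    intro z hz
    refine hdense z fun f => ?_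
    rw [← hSf, ← inner_conj_symm, hz _ ⟨f, rfl⟩, map_zero]
  have hmem : x' + (b : ℂ) • x ∈ closure (LinearMap.range S : Set E) := by
    rw [← Submodule.topologicalClosure_coe, hrange]; trivial
  obtain ⟨s, hs, hslim⟩ := mem_closure_iff_seq_limit.1 hmem
  choose g hg using hs
  have hcau : CauchySeq (fun n => J (g n)) := by
    have hs' := hslim.cauchySeq
    rw [Metric.cauchySeq_iff'] at hs' ⊢
    intro δ hδ
    obtain ⟨N, hN⟩ := hs' (ε * δ) (by positivity)
    refine ⟨N, fun n hn => ?_⟩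
    have := hN n hn
    rw [dist_eq_norm] at this ⊢
    rw [← map_sub]
    refine (hbd _).trans_lt ?_
    rw [map_sub, hg, hg, inv_mul_lt_iff₀ hε]
    exact this
  obtain ⟨y, hy⟩ := cauchySeq_tendsto_of_complete hcau
  have hHy : Tendsto (fun n => J (H (g n))) atTop (𝓝 (x' + (b : ℂ) • x - (b : ℂ) • y)) := by
    have := hslim.sub (hy.const_smul (b : ℂ))
    refine this.congr fun n => ?_
    rw [← hg, hSf, map_add, map_smul, add_sub_cancel_right]
  -- Closedness of A puts the limit y in its domain, with (A + b) y = (A + b) x. By symmetry x - y,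
  -- lying in the kernel of A + b, is orthogonal to the range of S, hence zero.
  have hyg : (y, x' + (b : ℂ) • x - (b : ℂ) • y) ∈ A.graph :=
    hA.isClosed.mem_of_tendsto (hy.prodMk_nhds hHy)
      (Eventually.of_forall fun n => hgraph (g n))
  have hdiff : (x - y, -((b : ℂ) • (x - y))) ∈ A.graph := by
    have := A.graph.sub_mem hx hyg
    rw [Prod.mk_sub_mk] at this
    convert this using 2
    rw [smul_sub]; abel
  have hxy : x - y = 0 := hdense _ fun f => by
    have h1 := symmetric_of_isSelfAdjoint hA hdiff (hgraph f)
    rw [map_add, map_smul, inner_add_right, ← h1, inner_neg_left, inner_smul_left,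
      inner_smul_right]
    simp
  rw [sub_eq_zero] at hxy
  subst hxy
  exact ⟨g, hy, by simpa using hHy⟩

namespace CoreData

variable {J : T →ₗ[ℂ] E} {H : T →ₗ[ℂ] T}

/-- Since A is its own adjoint, a weak identity tested on the core passes to the limit and becomes
membership in the graph. This is how ground states and kernel elements, which are not test vectors,
enter D(A). -/
lemma mem_graph (hC : CoreData J H A) {x x' : E}
    (h : ∀ g, inner ℂ x' (J g) = inner ℂ x (J (H g))) : (x, x') ∈ A.graph := by
  refine mem_graph_of_forall_inner hC.selfAdjoint fun y y' hy => ?_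
  obtain ⟨g, hg, hg'⟩ := hC.core y y' hy
  refine tendsto_nhds_unique (tendsto_const_nhds.inner hg) ?_
  simp_rw [h]
  exact tendsto_const_nhds.inner hg'

variable {D D' : T →ₗ[ℂ] T} {m : ℝ}

/-- If `H = D' D - m`, then `⟨(A + m) x, x⟩` is the limit of `‖D gₙ‖²` along a core sequence. -/
lemma exists_seq (hC : CoreData J H A) (hD : FormalAdjointOn J D D')
    (hH : ∀ f, H f = D' (D f) - (m : ℂ) • f) {x x' : E} (hx : (x, x') ∈ A.graph) :
    ∃ g : ℕ → T, Tendsto (fun n => J (g n)) atTop (𝓝 x) ∧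
      Tendsto (fun n => J (D' (D (g n)))) atTop (𝓝 (x' + (m : ℂ) • x)) ∧
      Tendsto (fun n => ‖J (D (g n))‖ ^ 2) atTop (𝓝 ((inner ℂ x x').re + m * ‖x‖ ^ 2)) := by
  obtain ⟨g, hg, hg'⟩ := hC.core x x' hx
  have h1 : Tendsto (fun n => J (D' (D (g n)))) atTop (𝓝 (x' + (m : ℂ) • x)) := by
    refine (hg'.add (hg.const_smul (m : ℂ))).congr fun n => ?_
    rw [hH, map_sub, map_smul, sub_add_cancel]
  refine ⟨g, hg, h1, ?_⟩
  have h2 := (Complex.continuous_re.tendsto _).comp (hg.inner h1)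
  have h3 : (inner ℂ x (x' + (m : ℂ) • x)).re = (inner ℂ x x').re + m * ‖x‖ ^ 2 := by
    rw [inner_add_right, inner_smul_right, inner_self_eq_norm_sq_to_K]
    simp [← Complex.ofReal_pow]
  rw [h3] at h2
  exact h2.congr fun n => hD.inner_self _

lemma form_nonneg (hC : CoreData J H A) (hD : FormalAdjointOn J D D')
    (hH : ∀ f, H f = D' (D f) - (m : ℂ) • f) {x x' : E} (hx : (x, x') ∈ A.graph) :
    0 ≤ (inner ℂ x x').re + m * ‖x‖ ^ 2 := by
  obtain ⟨g, -, -, hg⟩ := hC.exists_seq hD hH hx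
  exact ge_of_tendsto' hg fun n => by positivity

/-- A vanishing form forces D gₙ → 0 along a core sequence, so the limit x is orthogonal to the
range of D'; no closure of D has to be introduced. -/
lemma mem_span_of_form_eq_zero (hC : CoreData J H A) (hD : FormalAdjointOn J D D')
    (hH : ∀ f, H f = D' (D f) - (m : ℂ) • f) {e : E}
    (hker : ∀ x, (∀ h, inner ℂ x (J (D' h)) = 0) → x ∈ Submodule.span ℂ {e})
    {x x' : E} (hx : (x, x') ∈ A.graph) (h0 : (inner ℂ x x').re + m * ‖x‖ ^ 2 = 0) :
    x ∈ Submodule.span ℂ {e} := by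
  obtain ⟨g, hg, -, hg2⟩ := hC.exists_seq hD hH hx
  rw [h0] at hg2
  have hg3 : Tendsto (fun n => J (D (g n))) atTop (𝓝 0) := by
    rw [tendsto_zero_iff_norm_tendsto_zero]
    have := (Real.continuous_sqrt.tendsto _).comp hg2
    rw [Real.sqrt_zero] at this
    exact this.congr fun n => Real.sqrt_sq (norm_nonneg _)
  refine hker x fun h => ?_
  have h1 := hg.inner (𝕜 := ℂ) (tendsto_const_nhds (x := J (D' h)))
  have h2 := hg3.inner (𝕜 := ℂ) (tendsto_const_nhds (x := J h))
  rw [inner_zero_left] at h2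
  exact tendsto_nhds_unique h1 (h2.congr fun n => hD _ _)

lemma ground_mem_graph (hC : CoreData J H A) (hH : ∀ f, H f = D' (D f) - (m : ℂ) • f) {e : E}
    (he : ∀ h, inner ℂ e (J (D' h)) = 0) : (e, ((-m : ℝ) : ℂ) • e) ∈ A.graph := by
  refine hC.mem_graph fun g => ?_
  rw [hH, map_sub, map_smul, inner_sub_right, he, inner_smul_right, inner_smul_left]
  simp

lemma eigenspace_ground (hC : CoreData J H A) (hD : FormalAdjointOn J D D')
    (hH : ∀ f, H f = D' (D f) - (m : ℂ) • f) {e : E}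
    (he : ∀ h, inner ℂ e (J (D' h)) = 0)
    (hker : ∀ x, (∀ h, inner ℂ x (J (D' h)) = 0) → x ∈ Submodule.span ℂ {e}) :
    eigenspace A ((-m : ℝ) : ℂ) = Submodule.span ℂ {e} := by
  apply le_antisymm
  · intro x hx
    rw [mem_eigenspace_iff] at hx
    refine hC.mem_span_of_form_eq_zero hD hH hker hx ?_
    rw [inner_smul_right, inner_self_eq_norm_sq_to_K]
    simp [← Complex.ofReal_pow]
  · rw [Submodule.span_singleton_le_iff_mem, mem_eigenspace_iff]
    exact hC.ground_mem_graph hH he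

lemma form_pos_of_inner_eq_zero (hC : CoreData J H A) (hD : FormalAdjointOn J D D')
    (hH : ∀ f, H f = D' (D f) - (m : ℂ) • f) {e : E}
    (hker : ∀ x, (∀ h, inner ℂ x (J (D' h)) = 0) → x ∈ Submodule.span ℂ {e})
    {x x' : E} (hx : (x, x') ∈ A.graph) (hx0 : x ≠ 0) (hex : inner ℂ e x = 0) :
    0 < (inner ℂ x x').re + m * ‖x‖ ^ 2 := by
  refine lt_of_le_of_ne (hC.form_nonneg hD hH hx) fun h0 => hx0 ?_
  obtain ⟨c, rfl⟩ := Submodule.mem_span_singleton.1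
    (hC.mem_span_of_form_eq_zero hD hH hker hx h0.symm)
  rw [← inner_self_eq_zero (𝕜 := ℂ), inner_smul_left, hex, mul_zero]

/-- Spectral gap: if moreover `D D' = K' K + m` with `m > 0`, the form of `A` is nonnegative on the
orthogonal complement of the ground state. -/
lemma form_nonneg_of_inner_eq_zero (hC : CoreData J H A) (hD : FormalAdjointOn J D D')
    (hH : ∀ f, H f = D' (D f) - (m : ℂ) • f) {K K' : T →ₗ[ℂ] T} (hK : FormalAdjointOn J K K')
    (hDK : ∀ f, D (D' f) = K' (K f) + (m : ℂ) • f) (hm : 0 < m) {e : E}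
    (hker : ∀ x, (∀ h, inner ℂ x (J (D' h)) = 0) → x ∈ Submodule.span ℂ {e})
    {x x' : E} (hx : (x, x') ∈ A.graph) (hex : inner ℂ e x = 0) :
    0 ≤ (inner ℂ x x').re := by
  obtain ⟨g, hg, -, hg2⟩ := hC.exists_seq hD hH hx
  set Q := (inner ℂ x x').re + m * ‖x‖ ^ 2 with hQ
  have hQ0 : 0 ≤ Q := hC.form_nonneg hD hH hx
  -- This is D D' = K' K + m ≥ m.
  have hlow : ∀ h, m * ‖J h‖ ^ 2 ≤ ‖J (D' h)‖ ^ 2 := by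
    intro h
    rw [← hD.symm.inner_self, hDK, map_add, map_smul, inner_add_right, inner_smul_right,
      Complex.add_re, hK.inner_self, inner_self_eq_norm_sq_to_K]
    simp only [← Complex.ofReal_pow, Complex.coe_algebraMap, ← Complex.ofReal_mul,
      Complex.ofReal_re]
    nlinarith [sq_nonneg ‖J (K h)‖]
  have hstep : ∀ h, m * ‖inner ℂ x (J (D' h))‖ ^ 2 ≤ Q * ‖J (D' h)‖ ^ 2 := by
    intro h
    have h1 : Tendsto (fun n => m * ‖inner ℂ (J (g n)) (J (D' h))‖ ^ 2) atTop
        (𝓝 (m * ‖inner ℂ x (J (D' h))‖ ^ 2)) :=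
      ((hg.inner (𝕜 := ℂ) tendsto_const_nhds).norm.pow 2).const_mul m
    refine le_of_tendsto_of_tendsto' h1 (hg2.mul_const (‖J (D' h)‖ ^ 2)) fun n => ?_
    rw [← hD]
    have h2 := norm_inner_le_norm (𝕜 := ℂ) (J (D (g n))) (J h)
    calc m * ‖inner ℂ (J (D (g n))) (J h)‖ ^ 2 ≤ m * (‖J (D (g n))‖ * ‖J h‖) ^ 2 := by gcongr
      _ = ‖J (D (g n))‖ ^ 2 * (m * ‖J h‖ ^ 2) := by ring
      _ ≤ _ := by gcongr; exact hlow h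
  -- The complement of the range of D' lies in the span of e, so x ⊥ e is a limit of vectors D' h.
  -- Inserting these in `hstep` gives m ‖x‖⁴ ≤ Q ‖x‖², that is Q ≥ m ‖x‖².
  have hcl : x ∈ closure (LinearMap.range (J ∘ₗ D') : Set E) := by
    rw [← Submodule.topologicalClosure_coe, ← Submodule.orthogonal_orthogonal_eq_closure]
    intro z hz
    have hz' : z ∈ Submodule.span ℂ {e} := hker z fun h => by
      rw [← inner_conj_symm, show inner ℂ (J (D' h)) z = 0 from hz _ ⟨h, rfl⟩, map_zero]
    obtain ⟨c, rfl⟩ := Submodule.mem_span_singleton.1 hz'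
    rw [inner_smul_left, hex, mul_zero]
  obtain ⟨s, hs, hslim⟩ := mem_closure_iff_seq_limit.1 hcl
  choose h hh using hs
  have hfin : m * (‖x‖ ^ 2) ^ 2 ≤ Q * ‖x‖ ^ 2 := by
    have h1 : Tendsto (fun n => m * ‖inner ℂ x (s n)‖ ^ 2) atTop
        (𝓝 (m * ‖inner ℂ x x‖ ^ 2)) :=
      ((tendsto_const_nhds.inner (𝕜 := ℂ) hslim).norm.pow 2).const_mul m
    have h2 : ‖inner ℂ x x‖ = ‖x‖ ^ 2 := by
      rw [inner_self_eq_norm_sq_to_K]; simp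
    rw [h2] at h1
    refine le_of_tendsto_of_tendsto' h1 ((hslim.norm.pow 2).const_mul Q) fun n => ?_
    rw [← hh]
    exact hstep _
  by_cases hx0 : ‖x‖ ^ 2 = 0
  · have : x = 0 := by simpa using hx0
    simp [this]
  · have hpos : 0 < ‖x‖ ^ 2 := lt_of_le_of_ne (by positivity) (Ne.symm hx0)
    have : m * ‖x‖ ^ 2 ≤ Q := by
      refine le_of_mul_le_mul_right ?_ hpos
      calc _ = m * (‖x‖ ^ 2) ^ 2 := by ring
        _ ≤ _ := hfin
    rw [hQ] at this
    linarith

/-- The kernel of `A`, in the setting of the spectral gap, when the kernel of `K` is spanned by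
`k`. -/
lemma eigenspace_zero_of_gap (hC : CoreData J H A) (hD : FormalAdjointOn J D D')
    (hH : ∀ f, H f = D' (D f) - (m : ℂ) • f) {K K' : T →ₗ[ℂ] T} (hK : FormalAdjointOn J K K')
    (hDK : ∀ f, D (D' f) = K' (K f) + (m : ℂ) • f) (hm : 0 < m) {e k y : E}
    (he : ∀ h, inner ℂ e (J (D' h)) = 0)
    (hker : ∀ x, (∀ h, inner ℂ x (J (D' h)) = 0) → x ∈ Submodule.span ℂ {e})
    (hkerK : ∀ x, (∀ h, inner ℂ x (J (K' h)) = 0) → x ∈ Submodule.span ℂ {k})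
    {c₀ c₁ : ℂ} (hy : ∀ h, inner ℂ y (J (D' h)) = c₀ * inner ℂ k (J h))
    (hk : ∀ h, inner ℂ k (J (D h)) = c₁ * inner ℂ y (J h)) (hc : c₀ * c₁ = m) :
    eigenspace A 0 = Submodule.span ℂ {y} := by
  have hyA : (y, (0 : E)) ∈ A.graph := hC.mem_graph fun g => by
    rw [hH, map_sub, map_smul, inner_sub_right, hy, hk, inner_smul_right, inner_zero_left,
      ← mul_assoc, hc, sub_self]
  have hc₀ : c₀ ≠ 0 := by
    rintro rfl
    rw [zero_mul] at hc
    exact hm.ne' (by exact_mod_cast hc.symm)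
  apply le_antisymm
  · intro x hx
    rw [mem_eigenspace_iff, zero_smul] at hx
    obtain ⟨g, hg, hg1, hg2⟩ := hC.exists_seq hD hH hx
    rw [zero_add] at hg1
    rw [inner_zero_right, Complex.zero_re, zero_add] at hg2
    -- D' D gₙ converges and D D' ≥ m bounds ‖D f‖ by ‖D' D f‖ / √m.
    have hcau : CauchySeq (fun n => J (D (g n))) := by
      have hid : ∀ f, m * ‖J (D f)‖ ^ 2 ≤ ‖J (D' (D f))‖ ^ 2 := by
        intro f
        rw [← hD.symm.inner_self, hDK, map_add, map_smul, inner_add_right, inner_smul_right,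
          Complex.add_re, hK.inner_self, inner_self_eq_norm_sq_to_K]
        simp only [← Complex.ofReal_pow, Complex.coe_algebraMap, ← Complex.ofReal_mul,
          Complex.ofReal_re]
        nlinarith [sq_nonneg ‖J (K (D f))‖]
      have hs' := hg1.cauchySeq
      rw [Metric.cauchySeq_iff'] at hs' ⊢
      intro δ hδ
      obtain ⟨N, hN⟩ := hs' (Real.sqrt m * δ) (by positivity)
      refine ⟨N, fun n hn => ?_⟩
      have h1 := hN n hn
      rw [dist_eq_norm] at h1 ⊢
      rw [← map_sub, ← map_sub] at h1 ⊢
      rw [← map_sub] at h1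
      have h2 := hid (g n - g N)
      have h3 : ‖J (D' (D (g n - g N)))‖ ^ 2 < (Real.sqrt m * δ) ^ 2 := by
        gcongr
      rw [mul_pow, Real.sq_sqrt hm.le] at h3
      have h4 : ‖J (D (g n - g N))‖ ^ 2 < δ ^ 2 := lt_of_mul_lt_mul_left (h2.trans_lt h3) hm.le
      exact lt_of_pow_lt_pow_left₀ 2 hδ.le h4
    obtain ⟨v, hv⟩ := cauchySeq_tendsto_of_complete hcau
    have hv2 : ‖v‖ ^ 2 = m * ‖x‖ ^ 2 := tendsto_nhds_unique (hv.norm.pow 2) hg2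
    -- ‖K D g‖² = ‖D' D g‖² - m ‖D g‖², and with A x = 0 the two terms tend to the same limit m²
    -- ‖x‖².
    have hKg : Tendsto (fun n => J (K (D (g n)))) atTop (𝓝 0) := by
      have h1 : Tendsto (fun n => ‖J (K (D (g n)))‖ ^ 2) atTop (𝓝 0) := by
        have h2 := (hg1.norm.pow 2).sub (hg2.const_mul m)
        have h3 : ‖(m : ℂ) • x‖ ^ 2 - m * (m * ‖x‖ ^ 2) = 0 := by
          rw [norm_smul, mul_pow]; simp; ring
        rw [h3] at h2
        refine h2.congr fun n => ?_
        rw [← hD.symm.inner_self, hDK, map_add, map_smul, inner_add_right, inner_smul_right,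
          Complex.add_re, hK.inner_self, inner_self_eq_norm_sq_to_K]
        simp only [← Complex.ofReal_pow, Complex.coe_algebraMap, ← Complex.ofReal_mul,
          Complex.ofReal_re]
        ring
      rw [tendsto_zero_iff_norm_tendsto_zero]
      have := (Real.continuous_sqrt.tendsto _).comp h1
      rw [Real.sqrt_zero] at this
      exact this.congr fun n => Real.sqrt_sq (norm_nonneg _)
    have hvk : v ∈ Submodule.span ℂ {k} := hkerK v fun h => by
      have h1 := hv.inner (𝕜 := ℂ) (tendsto_const_nhds (x := J (K' h)))
      have h2 := hKg.inner (𝕜 := ℂ) (tendsto_const_nhds (x := J h))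
      rw [inner_zero_left] at h2
      exact tendsto_nhds_unique h1 (h2.congr fun n => hK _ _)
    obtain ⟨c, rfl⟩ := Submodule.mem_span_singleton.1 hvk
    -- Chosen so that d y and x have the same weak image c k under D; the conjugations come from the
    -- antilinear first slot.
    set d : ℂ := conj (conj c / c₀) with hd
    have hxd : x - d • y ∈ Submodule.span ℂ {e} := hker _ fun h => by
      have h1 := hg.inner (𝕜 := ℂ) (tendsto_const_nhds (x := J (D' h)))
      have h2 := hv.inner (𝕜 := ℂ) (tendsto_const_nhds (x := J h))
      have h3 := tendsto_nhds_unique h1 (h2.congr fun n => hD _ _)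
      rw [inner_sub_left, h3, inner_smul_left, inner_smul_left, hy, hd, Complex.conj_conj]
      field_simp
      ring
    obtain ⟨t, ht⟩ := Submodule.mem_span_singleton.1 hxd
    -- The difference is a multiple of e that A sends both to 0 and to -m times itself, so it
    -- vanishes.
    have hgr : (x - d • y, (0 : E)) ∈ A.graph := by
      have := A.graph.sub_mem hx (A.graph.smul_mem d hyA)
      simpa using this
    have hgr' : (t • e, t • ((-m : ℝ) : ℂ) • e) ∈ A.graph :=
      A.graph.smul_mem t (hC.ground_mem_graph hH he)
    rw [← ht] at hgr
    have h0 := A.mem_graph_snd_inj hgr' hgr rfl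
    rw [smul_comm, smul_eq_zero] at h0
    have h0' : t • e = 0 := h0.resolve_left (by simpa using hm.ne')
    rw [h0', eq_comm, sub_eq_zero] at ht
    rw [ht]
    exact Submodule.smul_mem _ _ (Submodule.mem_span_singleton_self y)
  · rw [Submodule.span_singleton_le_iff_mem, mem_eigenspace_iff, zero_smul]
    exact hyA

end CoreData

/-- Eigenvectors of a symmetric operator for different eigenvalues are orthogonal, so the gap
hypothesis applies to any other eigenvector. -/
lemma eigenvalue_nonneg_of_gap (hA : IsSelfAdjoint A) {μ : ℝ} {e : E}
    (he : (e, (μ : ℂ) • e) ∈ A.graph)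
    (hgap : ∀ x x', (x, x') ∈ A.graph → inner ℂ e x = 0 → 0 ≤ (inner ℂ x x').re)
    {ν : ℝ} (hν : eigenspace A (ν : ℂ) ≠ ⊥) (hne : ν ≠ μ) : 0 ≤ ν := by
  obtain ⟨x, hx, hx0⟩ := Submodule.exists_mem_ne_zero_of_ne_bot hν
  rw [mem_eigenspace_iff] at hx
  have h1 := symmetric_of_isSelfAdjoint hA he hx
  rw [inner_smul_left, inner_smul_right, Complex.conj_ofReal, ← sub_eq_zero, ← sub_mul,
    mul_eq_zero] at h1
  have h2 : inner ℂ e x = 0 := h1.resolve_left fun h => hne (by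
    rw [sub_eq_zero] at h; exact_mod_cast h.symm)
  have h3 := hgap _ _ hx h2
  rw [inner_smul_right, inner_self_eq_norm_sq_to_K] at h3
  simp only [Complex.coe_algebraMap, ← Complex.ofReal_pow, ← Complex.ofReal_mul,
    Complex.ofReal_re] at h3
  exact nonneg_of_mul_nonneg_left h3 (by positivity)

omit [CompleteSpace E] in
-- The functional ⟨e, ·⟩ is injective on a negative subspace, because a nonzero element of its
-- kernel would have nonnegative form. Hence dimension at most one, attained by the span of e.
lemma negIndex_eq_one_of_gap {μ : ℝ} (hμ : μ < 0) {e : E} (he0 : e ≠ 0)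
    (he : (e, (μ : ℂ) • e) ∈ A.graph)
    (hgap : ∀ x x', (x, x') ∈ A.graph → inner ℂ e x = 0 → 0 ≤ (inner ℂ x x').re) :
    negIndex A = 1 := by
  apply le_antisymm
  · refine iSup_le fun ⟨V, hV, hneg⟩ => ?_
    have hinj : Function.Injective ((innerₛₗ ℂ e) ∘ₗ V.subtype) := by
      rw [← LinearMap.ker_eq_bot, LinearMap.ker_eq_bot']
      rintro ⟨x, hx⟩ hx0
      by_contra hne
      have h1 := hneg ⟨x, hV hx⟩ hx (fun h => hne (by simpa using h))
      have h2 := hgap _ _ (A.mem_graph ⟨x, hV hx⟩) hx0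
      exact absurd h1 (not_lt.2 h2)
    have h := LinearMap.lift_rank_le_of_injective _ hinj
    rw [Module.rank_self, Cardinal.lift_one, Cardinal.lift_le_one_iff] at h
    exact (OrderHomClass.mono Cardinal.toENat h).trans_eq (map_one Cardinal.toENat)
  · have hs : IsNegativeSubspace A (Submodule.span ℂ {e}) := by
      refine ⟨?_, fun u hu hu0 => ?_⟩
      · rw [Submodule.span_singleton_le_iff_mem]
        exact LinearPMap.mem_domain_of_mem_graph he
      · obtain ⟨c, hc⟩ := Submodule.mem_span_singleton.1 hu
        have h1 : (c • e, c • (μ : ℂ) • e) ∈ A.graph := A.graph.smul_mem c he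
        have h2 := A.mem_graph_snd_inj (A.mem_graph u) h1 hc.symm
        rw [h2, ← hc, smul_comm, inner_smul_right, inner_self_eq_norm_sq_to_K, hc]
        simp only [Complex.coe_algebraMap, ← Complex.ofReal_pow, ← Complex.ofReal_mul,
          Complex.ofReal_re]
        have : (u : E) ≠ 0 := by simpa using hu0
        exact mul_neg_of_neg_of_pos hμ (by positivity)
    refine le_trans ?_ (le_iSup (fun V : {V : Submodule ℂ E // IsNegativeSubspace A V} =>
      Cardinal.toENat (Module.rank ℂ V.1)) ⟨_, hs⟩)
    have := Module.finrank_eq_rank ℂ (Submodule.span ℂ {e})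
    rw [← this, finrank_span_singleton he0]
    simp

end Abstract

end Compacton

/-! ### The compacton profile: first integral, smoothness, linear vanishing at the endpoints. -/

namespace Compacton

namespace IsCompacton

open Set Filter Topology

variable {p ω L : ℝ} {φ : ℝ → ℝ} (hφ : IsCompacton p ω L φ)
include hφ

lemma pos {x : ℝ} (hx : x ∈ Ioo (-L) L) : 0 < φ x := by
  have : φ x ≠ 0 := by rw [← hφ.support_eq] at hx; exact hx
  exact lt_of_le_of_ne (hφ.nonneg x) this.symm

lemma eq_zero {x : ℝ} (hx : x ∉ Ioo (-L) L) : φ x = 0 := by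
  rw [← hφ.support_eq] at hx
  simpa using hx

lemma hasDerivAt {x : ℝ} (hx : x ∈ Ioo (-L) L) : HasDerivAt φ (deriv φ x) x :=
  ((hφ.contDiffOn.contDiffAt (isOpen_Ioo.mem_nhds hx)).differentiableAt
    (by norm_num)).hasDerivAt

lemma contDiffOn_deriv : ContDiffOn ℝ 1 (deriv φ) (Ioo (-L) L) :=
  ((contDiffOn_succ_iff_deriv_of_isOpen (n := 1) isOpen_Ioo).1
    (by simpa [one_add_one_eq_two] using hφ.contDiffOn)).2.2

lemma hasDerivAt_deriv {x : ℝ} (hx : x ∈ Ioo (-L) L) :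
    HasDerivAt (deriv φ) (deriv (deriv φ) x) x :=
  ((hφ.contDiffOn_deriv.contDiffAt (isOpen_Ioo.mem_nhds hx)).differentiableAt
    (by norm_num)).hasDerivAt

lemma deriv_flux {x : ℝ} (hx : x ∈ Ioo (-L) L) :
    deriv (fun y => φ y * deriv φ y) x = ω - φ x ^ (p - 2) := by
  have h := hφ.profile x
  have h0 := hφ.pos hx
  rw [abs_of_pos h0] at h
  have : φ x * (ω - φ x ^ (p - 2) - deriv (fun y => φ y * deriv φ y) x) = 0 := by
    linear_combination h
  have := (mul_eq_zero.1 this).resolve_left h0.ne'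
  linarith

lemma hasDerivAt_flux {x : ℝ} (hx : x ∈ Ioo (-L) L) :
    HasDerivAt (fun y => φ y * deriv φ y) (ω - φ x ^ (p - 2)) x := by
  rw [← hφ.deriv_flux hx]
  exact ((hφ.hasDerivAt hx).mul (hφ.hasDerivAt_deriv hx)).differentiableAt.hasDerivAt

lemma flux_eq {x : ℝ} (hx : x ∈ Ioo (-L) L) :
    deriv (fun y => φ y ^ 2) x = 2 * (φ x * deriv φ x) := by
  rw [((hφ.hasDerivAt hx).fun_pow 2).deriv]
  simp; ring

lemma eventually_eq_zero {x : ℝ} (hx : x ∉ Icc (-L) L) : φ =ᶠ[𝓝 x] fun _ => 0 := by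
  filter_upwards [isClosed_Icc.isOpen_compl.mem_nhds hx] with y hy
  exact hφ.eq_zero fun h => hy (Ioo_subset_Icc_self h)

lemma deriv_eq_zero {x : ℝ} (hx : x ∉ Icc (-L) L) : deriv φ x = 0 := by
  rw [(hφ.eventually_eq_zero hx).deriv_eq]; simp

lemma deriv_flux_eq_zero {x : ℝ} (hx : x ∉ Icc (-L) L) :
    deriv (fun y => φ y * deriv φ y) x = 0 := by
  have : (fun y => φ y * deriv φ y) =ᶠ[𝓝 x] fun _ => 0 := by
    filter_upwards [hφ.eventually_eq_zero hx] with y hy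
    rw [hy, zero_mul]
  rw [this.deriv_eq]; simp

/-- The derivative of φ² is continuous and vanishes to the right of L. This fixes the constant of
the first integral. -/
lemma deriv_sq_boundary : deriv (fun y => φ y ^ 2) L = 0 := by
  have hc : Continuous (deriv (fun y => φ y ^ 2)) := hφ.contDiff_sq.continuous_deriv le_rfl
  have h1 : Tendsto (deriv (fun y => φ y ^ 2)) (𝓝[>] L) (𝓝 (deriv (fun y => φ y ^ 2) L)) :=
    (hc.tendsto L).mono_left nhdsWithin_le_nhds
  have h2 : Tendsto (deriv (fun y => φ y ^ 2)) (𝓝[>] L) (𝓝 0) := by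
    refine tendsto_const_nhds.congr' ?_
    filter_upwards [self_mem_nhdsWithin] with x hx
    have hx' : x ∉ Icc (-L) L := fun h => absurd hx (not_lt.2 h.2)
    have : (fun y => φ y ^ 2) =ᶠ[𝓝 x] fun _ => 0 := by
      filter_upwards [hφ.eventually_eq_zero hx'] with y hy
      rw [hy]; simp
    rw [this.deriv_eq]; simp
  exact tendsto_nhds_unique h1 h2

/-- The first integral of the profile equation. -/
lemma sq_deriv (hp : 2 < p) {x : ℝ} (hx : x ∈ Ioo (-L) L) :
    deriv φ x ^ 2 = ω - 2 / p * φ x ^ (p - 2) := by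
  have hp0 : 0 < p := by linarith
  -- The flux φ φ' is written as (φ²)'/2, which is continuous across L although φ itself need not be
  -- differentiable there.
  set F : ℝ → ℝ := fun y =>
    (deriv (fun z => φ z ^ 2) y / 2) ^ 2 - (ω * φ y ^ 2 - 2 / p * φ y ^ p) with hF
  have hFc : Continuous F := by
    have hc : Continuous (deriv (fun y => φ y ^ 2)) := hφ.contDiff_sq.continuous_deriv le_rfl
    have := hφ.continuous
    have h2 : Continuous fun y => φ y ^ p := this.rpow_const fun _ => Or.inr hp0.le
    fun_prop
  have hFd : ∀ y ∈ Ioo (-L) L, HasDerivAt F 0 y := by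
    intro y hy
    have h0 := hφ.pos hy
    have hG : F =ᶠ[𝓝 y] fun z => (φ z * deriv φ z) ^ 2 - (ω * φ z ^ 2 - 2 / p * φ z ^ p) := by
      filter_upwards [isOpen_Ioo.mem_nhds hy] with z hz
      simp only [hF]
      rw [hφ.flux_eq hz]
      ring
    refine HasDerivAt.congr_of_eventuallyEq ?_ hG
    have h1 := (hφ.hasDerivAt_flux hy).fun_pow 2
    have h2 := ((hφ.hasDerivAt hy).fun_pow 2).const_mul ω
    have h3 := ((hφ.hasDerivAt hy).rpow_const (p := p) (Or.inl h0.ne')).const_mul (2 / p)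
    convert h1.fun_sub (h2.fun_sub h3) using 1
    have h4 : φ y ^ (p - 1) = φ y ^ (p - 2) * φ y := by
      rw [← Real.rpow_add_one h0.ne']; ring_nf
    rw [h4]
    field_simp
    simp
    ring
  have hFx : F x = F L := by
    refine (constant_of_has_deriv_right_zero (f := F) (a := x) (b := L) hFc.continuousOn
      (fun y hy => ?_) L ⟨hx.2.le, le_rfl⟩).symm
    exact (hFd y ⟨hx.1.trans_le hy.1, hy.2⟩).hasDerivWithinAt
  have hFL : F L = 0 := by
    have : φ L = 0 := hφ.eq_zero (by simp)
    simp only [hF]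
    rw [hφ.deriv_sq_boundary, this, Real.zero_rpow hp0.ne']
    simp
  rw [hFL] at hFx
  simp only [hF] at hFx
  have h0 := hφ.pos hx
  have h5 : φ x ^ p = φ x ^ (p - 2) * φ x ^ 2 := by
    rw [← Real.rpow_natCast, ← Real.rpow_add h0]; norm_num
  rw [hφ.flux_eq hx, h5] at hFx
  have : φ x ^ 2 * (deriv φ x ^ 2 - (ω - 2 / p * φ x ^ (p - 2))) = 0 := by
    linear_combination hFx
  have := (mul_eq_zero.1 this).resolve_left (by positivity)
  linarith

lemma mul_deriv_deriv (hp : 2 < p) {x : ℝ} (hx : x ∈ Ioo (-L) L) :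
    φ x * deriv (deriv φ) x = -((p - 2) / p) * φ x ^ (p - 2) := by
  have h1 := ((hφ.hasDerivAt hx).mul (hφ.hasDerivAt_deriv hx)).deriv
  have h2 : deriv (fun y => φ y * deriv φ y) x = deriv (φ * deriv φ) x := rfl
  rw [← h2, hφ.deriv_flux hx] at h1
  have h3 := hφ.sq_deriv hp hx
  have hp0 : p ≠ 0 := by linarith
  field_simp at h3 ⊢
  linear_combination -p * h1 - h3

/-- Bootstrap: φ'' = -((p-2)/p) φ^(p-2)/φ is as regular as φ wherever φ > 0. -/
lemma contDiffOn_top (hp : 2 < p) : ContDiffOn ℝ (⊤ : ℕ∞) φ (Ioo (-L) L) := by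
  rw [contDiffOn_infty]
  have key : ∀ n : ℕ, ContDiffOn ℝ ((n + 2 : ℕ) : WithTop ℕ∞) φ (Ioo (-L) L) := by
    intro n
    induction n with
    | zero => exact_mod_cast hφ.contDiffOn
    | succ n ih =>
      have h1 : ContDiffOn ℝ ((n + 1 : ℕ) : WithTop ℕ∞) (deriv (deriv φ)) (Ioo (-L) L) := by
        have h2 : ContDiffOn ℝ ((n + 1 : ℕ) : WithTop ℕ∞) φ (Ioo (-L) L) :=
          ih.of_le (by exact_mod_cast (Nat.le_succ _))
        have h3 : ContDiffOn ℝ ((n + 1 : ℕ) : WithTop ℕ∞)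
            (fun x => -((p - 2) / p) * φ x ^ (p - 2) / φ x) (Ioo (-L) L) :=
          (contDiffOn_const.mul (h2.rpow_const_of_ne fun x hx => (hφ.pos hx).ne')).div h2
            fun x hx => (hφ.pos hx).ne'
        refine h3.congr fun x hx => ?_
        rw [eq_div_iff (hφ.pos hx).ne', mul_comm, hφ.mul_deriv_deriv hp hx]
      have h4 : ContDiffOn ℝ ((n + 1 : ℕ) + 1 : WithTop ℕ∞) (deriv φ) (Ioo (-L) L) := by
        rw [contDiffOn_succ_iff_deriv_of_isOpen isOpen_Ioo]
        exact ⟨fun x hx => (hφ.hasDerivAt_deriv hx).differentiableAt.differentiableWithinAt,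
          by simp, h1⟩
      have h5 : ContDiffOn ℝ ((n + 1 : ℕ) + 1 + 1 : WithTop ℕ∞) φ (Ioo (-L) L) := by
        rw [contDiffOn_succ_iff_deriv_of_isOpen isOpen_Ioo]
        exact ⟨fun x hx => (hφ.hasDerivAt hx).differentiableAt.differentiableWithinAt,
          by simp, h4⟩
      exact_mod_cast h5
  intro n
  exact (key n).of_le (by exact_mod_cast (Nat.le_add_right _ _))

lemma abs_deriv_le (hp : 2 < p) {x : ℝ} (hx : x ∈ Ioo (-L) L) : |deriv φ x| ≤ Real.sqrt ω := by
  apply Real.abs_le_sqrt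
  rw [hφ.sq_deriv hp hx]
  have := (hφ.pos hx).le
  have hp0 : 0 < p := by linarith
  have : 0 ≤ 2 / p * φ x ^ (p - 2) := by positivity
  linarith

/-- Mean value theorem with |φ'| ≤ √ω. This linear vanishing is what keeps negative powers φ^b, b ≤
-1, out of L². -/
lemma le_sqrt_mul (hp : 2 < p) {x : ℝ} (hx : x ∈ Ioo (-L) L) : φ x ≤ Real.sqrt ω * (L - x) := by
  have hL : φ L = 0 := hφ.eq_zero (by simp)
  obtain ⟨y, hy, h⟩ := exists_deriv_eq_slope φ hx.2 hφ.continuous.continuousOn fun y hy =>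
    (hφ.hasDerivAt ⟨hx.1.trans hy.1, hy.2⟩).differentiableAt.differentiableWithinAt
  have h1 := (abs_le.1 (hφ.abs_deriv_le hp ⟨hx.1.trans hy.1, hy.2⟩)).1
  rw [h, hL, le_div_iff₀ (by linarith [hx.2])] at h1
  linarith

lemma potMinus_eq {x : ℝ} (hx : x ∈ Ioo (-L) L) :
    potMinus p ω φ x = 2 * ω - 2 * φ x ^ (p - 2) := by
  rw [potMinus, hφ.deriv_flux hx]; ring

lemma potPlus_eq {x : ℝ} (hx : x ∈ Ioo (-L) L) :
    potPlus p ω φ x = -(p - 2) * φ x ^ (p - 2) := by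
  rw [potPlus, hφ.deriv_flux hx]; ring

lemma potMinus_eq_of_notMem (hp : 2 < p) {x : ℝ} (hx : x ∉ Icc (-L) L) :
    potMinus p ω φ x = ω := by
  rw [potMinus, hφ.deriv_flux_eq_zero hx, (hφ.eventually_eq_zero hx).eq_of_nhds,
    Real.zero_rpow (by linarith)]
  ring

lemma potPlus_eq_of_notMem (hp : 2 < p) {x : ℝ} (hx : x ∉ Icc (-L) L) :
    potPlus p ω φ x = ω := by
  rw [potPlus, hφ.deriv_flux_eq_zero hx, (hφ.eventually_eq_zero hx).eq_of_nhds,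
    Real.zero_rpow (by linarith)]
  ring

end IsCompacton

end Compacton

/-! ### Test functions and du Bois-Reymond lemmas. -/

namespace Compacton

section Tests

open Set Filter Topology

variable {U V : Set ℝ} {f g : ℝ → ℂ}

lemma IsTest.mono (hf : IsTest U f) (h : U ⊆ V) : IsTest V f :=
  ⟨hf.smooth, hf.compact, hf.subset.trans h⟩

lemma IsTest.eq_zero (hf : IsTest U f) {x : ℝ} (hx : x ∉ U) : f x = 0 :=
  image_eq_zero_of_notMem_tsupport fun h => hx (hf.subset h)

lemma IsTest.integrable (hf : IsTest U f) : Integrable f :=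
  hf.smooth.continuous.integrable_of_hasCompactSupport hf.compact

lemma IsTest.differentiable (hf : IsTest U f) : Differentiable ℝ f :=
  hf.smooth.differentiable (by simp)

lemma IsTest.zero : IsTest U (0 : ℝ → ℂ) :=
  ⟨contDiff_const, HasCompactSupport.zero, by simp [tsupport]⟩

lemma IsTest.add (hf : IsTest U f) (hg : IsTest U g) : IsTest U (f + g) :=
  ⟨hf.smooth.add hg.smooth, hf.compact.add hg.compact,
    (tsupport_add f g).trans (union_subset hf.subset hg.subset)⟩

lemma IsTest.hasTestDeriv (hf : IsTest U f) : IsTest U (deriv f) :=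
  ⟨(contDiff_infty_iff_deriv.1 hf.smooth).2, hf.compact.deriv,
    tsupport_deriv_subset.trans hf.subset⟩

/-- Multiplication of a test function by a function that is smooth on the open set. -/
lemma IsTest.mul_left (hU : IsOpen U) {a : ℝ → ℂ} (ha : ContDiffOn ℝ (⊤ : ℕ∞) a U)
    (hf : IsTest U f) : IsTest U (fun x => a x * f x) := by
  have hsub : tsupport (fun x => a x * f x) ⊆ tsupport f :=
    closure_mono fun x hx hfx => hx (by simp [hfx])
  refine ⟨?_, hf.compact.mul_left, hsub.trans hf.subset⟩
  rw [contDiff_iff_contDiffAt]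
  intro x
  by_cases hx : x ∈ tsupport f
  · exact (ha.contDiffAt (hU.mem_nhds (hf.subset hx))).mul hf.smooth.contDiffAt
  · have : (fun x => a x * f x) =ᶠ[𝓝 x] fun _ => 0 := by
      filter_upwards [(isClosed_tsupport f).isOpen_compl.mem_nhds hx] with y hy
      rw [image_eq_zero_of_notMem_tsupport hy, mul_zero]
    exact contDiffAt_const.congr_of_eventuallyEq this

lemma IsTest.const_smul (hf : IsTest U f) (c : ℂ) : IsTest U (c • f) :=
  ⟨hf.smooth.const_smul c, hf.compact.smul_left (f := fun _ => c),
    (closure_mono fun x (hx : c • f x ≠ 0) (hfx : f x = 0) =>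
      hx (by rw [hfx, smul_zero])).trans hf.subset⟩

lemma contDiffOn_ofReal {a : ℝ → ℝ} (ha : ContDiffOn ℝ (⊤ : ℕ∞) a U) :
    ContDiffOn ℝ (⊤ : ℕ∞) (fun x => (a x : ℂ)) U :=
  Complex.ofRealCLM.contDiff.comp_contDiffOn ha

lemma contDiffOn_conj {a : ℝ → ℂ} (ha : ContDiffOn ℝ (⊤ : ℕ∞) a U) :
    ContDiffOn ℝ (⊤ : ℕ∞) (fun x => conj (a x)) U :=
  Complex.conjCLE.contDiff.comp_contDiffOn ha

lemma IsTest.real_mul (hU : IsOpen U) {a : ℝ → ℝ} (ha : ContDiffOn ℝ (⊤ : ℕ∞) a U)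
    (hf : IsTest U f) : IsTest U (fun x => (a x : ℂ) * f x) :=
  hf.mul_left hU (contDiffOn_ofReal ha)

lemma IsTest.integral_deriv (hf : IsTest U f) : ∫ x, _root_.deriv f x = 0 :=
  integral_eq_zero_of_hasDerivAt_of_integrable (fun x => (hf.differentiable x).hasDerivAt)
    hf.hasTestDeriv.integrable hf.integrable

lemma IsTest.of_real {a : ℝ → ℝ} (h1 : ContDiff ℝ (⊤ : ℕ∞) a) (h2 : HasCompactSupport a)
    (h3 : tsupport a ⊆ U) : IsTest U (fun x => (a x : ℂ)) :=
  ⟨Complex.ofRealCLM.contDiff.comp h1, h2.comp_left (g := ((↑) : ℝ → ℂ)) (by simp),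
    (closure_mono fun x (hx : (a x : ℂ) ≠ 0) (hfx : a x = 0) =>
      hx (by rw [hfx, Complex.ofReal_zero])).trans h3⟩

/-- A test function on an interval with vanishing integral is the derivative of a test function. -/
lemma IsTest.exists_primitive {a b : ℝ} (hg : IsTest (Ioo a b) g) (h0 : ∫ x, g x = 0) :
    ∃ h, IsTest (Ioo a b) h ∧ deriv h = g := by
  set h : ℝ → ℂ := fun x => ∫ t in a..x, g t with hh
  have hgi := hg.integrable
  have hd : ∀ x, HasDerivAt h (g x) x := fun x =>
    intervalIntegral.integral_hasDerivAt_right hgi.intervalIntegrable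
      (hg.smooth.continuous.stronglyMeasurableAtFilter _ _) hg.smooth.continuous.continuousAt
  have hderiv : _root_.deriv h = g := funext fun x => (hd x).deriv
  have hsm : ContDiff ℝ (⊤ : ℕ∞) h :=
    contDiff_infty_iff_deriv.2 ⟨fun x => (hd x).differentiableAt, hderiv ▸ hg.smooth⟩
  by_cases hne : (tsupport g).Nonempty
  swap
  · have hg0 : g = 0 := by
      rw [← tsupport_eq_empty_iff]; exact not_nonempty_iff_eq_empty.1 hne
    exact ⟨0, IsTest.zero, by rw [hg0]; ext x; simp [Pi.zero_def]⟩
  obtain ⟨α, hα, hαle⟩ := hg.compact.isCompact.exists_isLeast hne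
  obtain ⟨β, hβ, hβle⟩ := hg.compact.isCompact.exists_isGreatest hne
  have hgα : ∀ x, x < α → g x = 0 := fun x hx =>
    image_eq_zero_of_notMem_tsupport fun h => absurd (hαle h) (not_le.2 hx)
  have hgβ : ∀ x, β < x → g x = 0 := fun x hx =>
    image_eq_zero_of_notMem_tsupport fun h => absurd (hβle h) (not_le.2 hx)
  have haα := (hg.subset hα).1
  have hβb := (hg.subset hβ).2
  have hleft : ∀ x, x < α → h x = 0 := by
    intro x hx
    rw [hh]
    simp only
    rw [intervalIntegral.integral_congr (g := fun _ => (0 : ℂ)), intervalIntegral.integral_zero]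
    intro t ht
    exact hgα t (ht.2.trans_lt (max_lt haα hx))
  have hright : ∀ x, β < x → h x = 0 := by
    intro x hx
    have hax : a ≤ x := (haα.le.trans (hαle hβ)).trans hx.le
    rw [hh]
    simp only
    rw [intervalIntegral.integral_of_le hax, ← h0]
    refine setIntegral_eq_integral_of_forall_compl_eq_zero fun t ht => ?_
    by_cases hta : t ≤ a
    · exact hgα t (hta.trans_lt haα)
    · exact hgβ t (hx.trans (by by_contra hc; exact ht ⟨not_le.1 hta, not_lt.1 hc⟩))
  have hsupp : tsupport h ⊆ Icc α β := by
    refine closure_minimal (fun x hx => ?_) isClosed_Icc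
    by_contra hc
    rw [mem_Icc, not_and_or, not_le, not_le] at hc
    exact hx (hc.elim (hleft x) (hright x))
  exact ⟨h, ⟨hsm, isCompact_Icc.of_isClosed_subset (isClosed_tsupport h) hsupp,
    hsupp.trans (Icc_subset_Ioo haα hβb)⟩, hderiv⟩

lemma exists_isTest_integral_ne_zero {a b : ℝ} (hab : a < b) {ρ : ℝ → ℝ}
    (hρ : ContinuousOn ρ (Ioo a b)) (hpos : ∀ x ∈ Ioo a b, 0 < ρ x) :
    ∃ g : ℝ → ℂ, IsTest (Ioo a b) g ∧ ∫ x, (ρ x : ℂ) * g x = 1 := by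
  set c := (a + b) / 2 with hc
  have hr : 0 < (b - a) / 4 := by linarith
  let B : ContDiffBump c := ⟨(b - a) / 4, (b - a) / 3, hr, by linarith⟩
  have hB : IsTest (Ioo a b) (fun x => (B x : ℂ)) := by
    refine IsTest.of_real B.contDiff B.hasCompactSupport ?_
    rw [B.tsupport_eq, Real.closedBall_eq_Icc]
    exact Icc_subset_Ioo (by simp only [hc, B]; linarith) (by simp only [hc, B]; linarith)
  have hcm : c ∈ Ioo a b := ⟨by simp only [hc]; linarith, by simp only [hc]; linarith⟩
  have hcont : Continuous fun x => ρ x * B x := by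
    rw [continuous_iff_continuousAt]
    intro x
    by_cases hx : x ∈ tsupport B
    · have : x ∈ Ioo a b := by
        refine Icc_subset_Ioo ?_ ?_ (Real.closedBall_eq_Icc ▸ B.tsupport_eq ▸ hx)
        · simp only [hc, B]; linarith
        · simp only [hc, B]; linarith
      exact (hρ.continuousAt (isOpen_Ioo.mem_nhds this)).mul B.continuous.continuousAt
    · have : (fun x => ρ x * B x) =ᶠ[𝓝 x] fun _ => 0 := by
        filter_upwards [(isClosed_tsupport B).isOpen_compl.mem_nhds hx] with y hy
        rw [image_eq_zero_of_notMem_tsupport hy, mul_zero]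
      exact continuousAt_const.congr this.symm
  have hint : 0 < ∫ x, ρ x * B x := by
    refine hcont.integral_pos_of_hasCompactSupport_nonneg_nonzero B.hasCompactSupport.mul_left
      (fun x => ?_) (x := c) ?_
    · by_cases hx : x ∈ Ioo a b
      · exact mul_nonneg (hpos x hx).le B.nonneg
      · have : (B x : ℂ) = 0 := hB.eq_zero hx
        have : B x = 0 := by exact_mod_cast this
        simp [this]
    · have : B c = 1 := B.one_of_mem_closedBall (by simp [hr.le, B])
      rw [this, mul_one]
      exact (hpos c hcm).ne'
  refine ⟨((∫ x, ρ x * B x : ℝ) : ℂ)⁻¹ • fun x => (B x : ℂ), hB.const_smul _, ?_⟩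
  have : ∀ x, (ρ x : ℂ) * ((((∫ x, ρ x * B x : ℝ) : ℂ)⁻¹ • fun x => (B x : ℂ)) x)
      = ((∫ x, ρ x * B x : ℝ) : ℂ)⁻¹ * ((ρ x * B x : ℝ) : ℂ) := by
    intro x
    simp only [Pi.smul_apply, smul_eq_mul, Complex.ofReal_mul]; ring
  simp_rw [this]
  rw [integral_const_mul, integral_complex_ofReal, inv_mul_cancel₀]
  exact_mod_cast hint.ne'

lemma _root_.MeasureTheory.LocallyIntegrableOn.integrable_mul_isTest {W : ℝ → ℂ}
    (hW : LocallyIntegrableOn W U) (hg : IsTest U g) : Integrable fun x => W x * g x := by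
  have h1 : IntegrableOn W (tsupport g) :=
    hW.integrableOn_compact_subset hg.subset hg.compact
  have h2 : IntegrableOn (fun x => W x * g x) (tsupport g) :=
    h1.mul_continuousOn hg.smooth.continuous.continuousOn hg.compact
  rwa [integrableOn_iff_integrable_of_support_subset] at h2
  exact fun x hx => subset_tsupport g (right_ne_zero_of_mul hx)

lemma ae_eq_zero_of_integral_isTest {W : ℝ → ℂ} (hU : IsOpen U) (hW : LocallyIntegrableOn W U)
    (h : ∀ g, IsTest U g → ∫ x, W x * g x = 0) : ∀ᵐ x, x ∈ U → W x = 0 := by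
  refine hU.ae_eq_zero_of_integral_contDiff_smul_eq_zero hW fun g h1 h2 h3 => ?_
  rw [← h _ (IsTest.of_real h1 h2 h3)]
  refine integral_congr_ae (Eventually.of_forall fun x => ?_)
  simp only [Complex.real_smul]; ring

/-- The du Bois-Reymond lemma. -/
lemma ae_eq_const_of_integral_deriv {W : ℝ → ℂ} {a b : ℝ} (hab : a < b)
    (hW : LocallyIntegrableOn W (Ioo a b))
    (h : ∀ g, IsTest (Ioo a b) g → ∫ x, W x * deriv g x = 0) :
    ∃ c, ∀ᵐ x, x ∈ Ioo a b → W x = c := by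
  obtain ⟨g₀, hg₀, hg₀1⟩ := exists_isTest_integral_ne_zero hab (ρ := fun _ => 1)
    continuousOn_const fun _ _ => one_pos
  simp only [Complex.ofReal_one, one_mul] at hg₀1
  refine ⟨∫ x, W x * g₀ x, ?_⟩
  set c := ∫ x, W x * g₀ x with hc
  have hcl : LocallyIntegrableOn (fun _ : ℝ => c) (Ioo a b) :=
    (locallyIntegrable_const c).locallyIntegrableOn _
  have := ae_eq_zero_of_integral_isTest isOpen_Ioo (W := fun x => W x - c) (hW.sub hcl) ?_
  · filter_upwards [this] with x hx hxI
    exact sub_eq_zero.1 (hx hxI)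
  intro g hg
  -- Subtracting a multiple of g₀ makes the integral zero, so that the difference has a compactly
  -- supported primitive.
  have h1 : IsTest (Ioo a b) (g + (-(∫ x, g x)) • g₀) := hg.add (hg₀.const_smul _)
  obtain ⟨k, hk, hkd⟩ := h1.exists_primitive (by
    have : ∀ x, (g + (-(∫ x, g x)) • g₀) x = g x + (-(∫ x, g x)) * g₀ x := fun x => rfl
    simp_rw [this]
    rw [integral_add hg.integrable (hg₀.integrable.const_mul _), integral_const_mul, hg₀1]
    ring)
  have h2 := h k hk
  rw [hkd] at h2
  have i1 := hW.integrable_mul_isTest hg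
  have i2 := hW.integrable_mul_isTest hg₀
  have e1 : ∀ x, W x * (g + (-(∫ x, g x)) • g₀) x = W x * g x + (-(∫ x, g x)) * (W x * g₀ x) :=
    fun x => by simp only [Pi.add_apply, Pi.smul_apply, smul_eq_mul]; ring
  simp_rw [e1] at h2
  rw [integral_add i1 (i2.const_mul _), integral_const_mul, ← hc] at h2
  simp_rw [sub_mul]
  rw [integral_sub i1 (hg.integrable.const_mul c), integral_const_mul]
  linear_combination h2

/-- If `W` is orthogonal to all `(w k')'`, where `ρ = w⁻¹ = G'`, then `W` is an affine function
of `G`. -/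
lemma ae_eq_of_integral_deriv_mul_deriv {W : ℝ → ℂ} {a b : ℝ} (hab : a < b)
    (hW : LocallyIntegrableOn W (Ioo a b)) {ρ G : ℝ → ℝ}
    (hρ : ContDiffOn ℝ (⊤ : ℕ∞) ρ (Ioo a b)) (hpos : ∀ x ∈ Ioo a b, 0 < ρ x)
    (hG : ∀ x ∈ Ioo a b, HasDerivAt G (ρ x) x)
    (h : ∀ k, IsTest (Ioo a b) k → ∫ x, W x * deriv (fun y => (ρ y : ℂ)⁻¹ * deriv k y) x = 0) :
    ∃ c d : ℂ, ∀ᵐ x, x ∈ Ioo a b → W x = c + d * G x := by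
  obtain ⟨g₀, hg₀, hg₀1⟩ := exists_isTest_integral_ne_zero hab hρ.continuousOn hpos
  set c := ∫ x, W x * deriv g₀ x with hc
  have hGc : ContinuousOn (fun x => c * (G x : ℂ)) (Ioo a b) := fun x hx =>
    (continuousAt_const.mul (Complex.continuous_ofReal.continuousAt.comp
      (hG x hx).continuousAt)).continuousWithinAt
  have hGl : LocallyIntegrableOn (fun x => c * (G x : ℂ)) (Ioo a b) :=
    hGc.locallyIntegrableOn measurableSet_Ioo
  obtain ⟨c', hc'⟩ := ae_eq_const_of_integral_deriv hab (W := fun x => W x + c * G x)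
    (hW.add hGl) (by
      intro l hl
      set r := ∫ x, (ρ x : ℂ) * l x with hr
      -- Now ρ (l - r g₀) has integral zero, so it is k' for a test function k, and ρ⁻¹ k' = l - r
      -- g₀ is admissible in the hypothesis. The leftover r c is cancelled by the integral of c G
      -- l', which equals -c r.
      have h1 : IsTest (Ioo a b) (l + (-r) • g₀) := hl.add (hg₀.const_smul _)
      have iρ : ∀ {f}, IsTest (Ioo a b) f → Integrable fun x => (ρ x : ℂ) * f x := fun hf =>
        (hf.real_mul isOpen_Ioo hρ).integrable
      obtain ⟨k, hk, hkd⟩ := (h1.real_mul isOpen_Ioo hρ).exists_primitive (by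
        have : ∀ x, (ρ x : ℂ) * (l + (-r) • g₀) x = ρ x * l x + (-r) * (ρ x * g₀ x) :=
          fun x => by simp only [Pi.add_apply, Pi.smul_apply, smul_eq_mul]; ring
        simp_rw [this]
        rw [integral_add (iρ hl) ((iρ hg₀).const_mul _), integral_const_mul, hg₀1, ← hr]
        ring)
      have h2 := h k hk
      have h3 : (fun y => (ρ y : ℂ)⁻¹ * deriv k y) = l + (-r) • g₀ := by
        funext y
        rw [hkd]
        by_cases hy : y ∈ Ioo a b
        · rw [inv_mul_cancel_left₀]
          exact_mod_cast (hpos y hy).ne'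
        · simp only
          rw [h1.eq_zero hy, mul_zero, mul_zero]
      rw [h3] at h2
      have h4 : deriv (l + (-r) • g₀) = fun x => deriv l x + (-r) * deriv g₀ x := by
        funext x
        exact (((hl.differentiable x).hasDerivAt).add
          ((hg₀.differentiable x).hasDerivAt.const_smul (-r))).deriv
      rw [h4] at h2
      have i1 := hW.integrable_mul_isTest hl.hasTestDeriv
      have i2 := hW.integrable_mul_isTest hg₀.hasTestDeriv
      have e1 : ∀ x, W x * (deriv l x + (-r) * deriv g₀ x)
          = W x * deriv l x + (-r) * (W x * deriv g₀ x) := fun x => by ring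
      simp_rw [e1] at h2
      rw [integral_add i1 (i2.const_mul _), integral_const_mul, ← hc] at h2
      have i3 := hGl.integrable_mul_isTest hl.hasTestDeriv
      have h5 : ∫ x, (c * (G x : ℂ)) * deriv l x = - ∫ x, (c * (ρ x : ℂ)) * l x := by
        have hd : ∀ x, HasDerivAt (fun x => (c * (G x : ℂ)) * l x)
            ((c * (ρ x : ℂ)) * l x + (c * (G x : ℂ)) * deriv l x) x := by
          intro x
          by_cases hx : x ∈ tsupport l
          · exact ((hG x (hl.subset hx)).ofReal_comp.const_mul c).mul
              (hl.differentiable x).hasDerivAt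
          · have e0 : (fun x => (c * (G x : ℂ)) * l x) =ᶠ[𝓝 x] fun _ => 0 := by
              filter_upwards [(isClosed_tsupport l).isOpen_compl.mem_nhds hx] with y hy
              rw [image_eq_zero_of_notMem_tsupport hy, mul_zero]
            have e2 : deriv l x = 0 :=
              image_eq_zero_of_notMem_tsupport fun h => hx (tsupport_deriv_subset h)
            rw [image_eq_zero_of_notMem_tsupport hx, e2, mul_zero, mul_zero, add_zero]
            exact (hasDerivAt_const x (0 : ℂ)).congr_of_eventuallyEq e0
        have i4 : Integrable fun x => (c * (ρ x : ℂ)) * l x := by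
          simpa only [mul_assoc] using (iρ hl).const_mul c
        have := integral_eq_zero_of_hasDerivAt_of_integrable hd (i4.add i3)
          (hGl.integrable_mul_isTest hl)
        rw [integral_add i4 i3] at this
        linear_combination this
      simp_rw [add_mul]
      rw [integral_add i1 i3, h5]
      simp_rw [mul_assoc]
      rw [integral_const_mul, ← hr]
      linear_combination h2)
  refine ⟨c', -c, ?_⟩
  filter_upwards [hc'] with x hx hxI
  linear_combination hx hxI

end Tests

end Compacton

/-! ### First-order differential operators on test functions and their formal adjoints. -/

namespace Compacton

section Operators

open Set Filter Topology

variable {U Ω : Set ℝ}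

/-- The space of test functions on `U`. -/
def testSpace (U : Set ℝ) : Submodule ℂ (ℝ → ℂ) where
  carrier := {f | IsTest U f}
  add_mem' hf hg := hf.add hg
  zero_mem' := IsTest.zero
  smul_mem' c _ hf := hf.const_smul c

lemma contDiffOn_deriv_of_isOpen {F : Type*} [NormedAddCommGroup F] [NormedSpace ℝ F]
    (hU : IsOpen U) {a : ℝ → F} (ha : ContDiffOn ℝ (⊤ : ℕ∞) a U) :
    ContDiffOn ℝ (⊤ : ℕ∞) (deriv a) U :=
  ((contDiffOn_infty_iff_deriv_of_isOpen hU).1 ha).2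

lemma hasDerivAt_of_contDiffOn {F : Type*} [NormedAddCommGroup F] [NormedSpace ℝ F]
    (hU : IsOpen U) {a : ℝ → F} (ha : ContDiffOn ℝ (⊤ : ℕ∞) a U) {x : ℝ} (hx : x ∈ U) :
    HasDerivAt a (deriv a x) x :=
  ((ha.contDiffAt (hU.mem_nhds hx)).differentiableAt (by simp)).hasDerivAt

/-- The differential operator `f ↦ s f' + r f` on test functions. -/
noncomputable def firstOrder (hU : IsOpen U) {s r : ℝ → ℝ} (hs : ContDiffOn ℝ (⊤ : ℕ∞) s U)
    (hr : ContDiffOn ℝ (⊤ : ℕ∞) r U) : testSpace U →ₗ[ℂ] testSpace U where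
  toFun f := ⟨fun x => s x * deriv f x + r x * f.1 x,
    IsTest.add (f.2.hasTestDeriv.real_mul hU hs) (f.2.real_mul hU hr)⟩
  map_add' f g := by
    ext x
    have : deriv (f.1 + g.1) x = deriv f.1 x + deriv g.1 x :=
      ((f.2.differentiable x).hasDerivAt.add (g.2.differentiable x).hasDerivAt).deriv
    simp only [Submodule.coe_add, this, Pi.add_apply]
    ring
  map_smul' c f := by
    ext x
    have : deriv (c • f.1) x = c * deriv f.1 x :=
      ((f.2.differentiable x).hasDerivAt.const_smul c).deriv
    simp only [SetLike.val_smul, this, Pi.smul_apply, smul_eq_mul, RingHom.id_apply]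
    ring

/-- The formal adjoint `f ↦ -(s f)' + r f` of `f ↦ s f' + r f`. -/
noncomputable def firstOrderAdj (hU : IsOpen U) {s r : ℝ → ℝ} (hs : ContDiffOn ℝ (⊤ : ℕ∞) s U)
    (hr : ContDiffOn ℝ (⊤ : ℕ∞) r U) : testSpace U →ₗ[ℂ] testSpace U :=
  firstOrder hU (s := fun x => -s x) (r := fun x => r x - deriv s x) hs.neg
    (hr.sub (contDiffOn_deriv_of_isOpen hU hs))

lemma integral_mul_deriv_isTest (hU : IsOpen U) {e h : ℝ → ℂ}
    (he : ContDiffOn ℝ (⊤ : ℕ∞) e U) (hh : IsTest U h) :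
    ∫ x, e x * deriv h x = -∫ x, deriv e x * h x := by
  have h1 := (hh.mul_left hU he).integral_deriv
  have i1 := (hh.hasTestDeriv.mul_left hU he).integrable
  have i2 := (hh.mul_left hU (contDiffOn_deriv_of_isOpen hU he)).integrable
  have : ∀ x, deriv (fun y => e y * h y) x = deriv e x * h x + e x * deriv h x := by
    intro x
    by_cases hx : x ∈ U
    · exact ((hasDerivAt_of_contDiffOn hU he hx).mul (hh.differentiable x).hasDerivAt).deriv
    · rw [hh.eq_zero hx, hh.hasTestDeriv.eq_zero hx, (hh.mul_left hU he).hasTestDeriv.eq_zero hx]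
      simp
  simp_rw [this] at h1
  rw [integral_add i2 i1] at h1
  linear_combination h1

/-- Only h has compact support in U; e is merely smooth there, so the identity applies to φ^a and φ'
without any boundary condition at ± L. -/
lemma integral_conj_mul_firstOrderAdj (hU : IsOpen U) {s r : ℝ → ℝ}
    (hs : ContDiffOn ℝ (⊤ : ℕ∞) s U) (hr : ContDiffOn ℝ (⊤ : ℕ∞) r U) {e : ℝ → ℂ}
    (he : ContDiffOn ℝ (⊤ : ℕ∞) e U) (h : testSpace U) :
    ∫ x, conj (e x) * (firstOrderAdj hU hs hr h).1 x
      = ∫ x, conj (s x * deriv e x + r x * e x) * h.1 x := by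
  have hce := contDiffOn_conj he
  have hsh := h.2.real_mul hU hs
  have h1 := integral_mul_deriv_isTest hU hce hsh
  have i1 := (hsh.hasTestDeriv.mul_left hU hce).integrable
  have i2 := ((h.2.real_mul hU hr).mul_left hU hce).integrable
  have i3 := (hsh.mul_left hU (contDiffOn_deriv_of_isOpen hU hce)).integrable
  have e1 : ∀ x, conj (e x) * (firstOrderAdj hU hs hr h).1 x
      = conj (e x) * (r x * h.1 x) - conj (e x) * deriv (fun y => (s y : ℂ) * h.1 y) x := by
    intro x
    by_cases hx : x ∈ U
    · have h2 : deriv (fun y => (s y : ℂ) * h.1 y) x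
          = (deriv s x : ℝ) * h.1 x + s x * deriv h.1 x :=
        ((hasDerivAt_of_contDiffOn hU hs hx).ofReal_comp.mul
          (h.2.differentiable x).hasDerivAt).deriv
      rw [h2]
      simp only [firstOrderAdj, firstOrder, LinearMap.coe_mk, AddHom.coe_mk, Complex.ofReal_neg,
        Complex.ofReal_sub]
      ring
    · rw [h.2.eq_zero hx, hsh.hasTestDeriv.eq_zero hx, (firstOrderAdj hU hs hr h).2.eq_zero hx]
      simp
  have e2 : ∀ x, conj (s x * deriv e x + r x * e x) * h.1 x
      = conj (e x) * (r x * h.1 x) + deriv (fun y => conj (e y)) x * (s x * h.1 x) := by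
    intro x
    have : deriv (fun y => conj (e y)) x = conj (deriv e x) := deriv.star
    rw [this]
    simp only [map_add, map_mul, Complex.conj_ofReal]
    ring
  simp_rw [e1, e2]
  rw [integral_sub i2 i1, integral_add i2 i3, h1]
  ring

lemma firstOrderAdj_comp_apply (hU : IsOpen U) {s r : ℝ → ℝ}
    (hs : ContDiffOn ℝ (⊤ : ℕ∞) s U) (hr : ContDiffOn ℝ (⊤ : ℕ∞) r U) (f : testSpace U) {x : ℝ}
    (hx : x ∈ U) : (firstOrderAdj hU hs hr (firstOrder hU hs hr f)).1 x
      = -(s x ^ 2 : ℝ) * deriv (deriv f.1) x - (2 * s x * deriv s x : ℝ) * deriv f.1 x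
        + (r x ^ 2 - s x * deriv r x - deriv s x * r x : ℝ) * f.1 x := by
  have hf := (f.2.differentiable x).hasDerivAt
  have hf' := (f.2.hasTestDeriv.differentiable x).hasDerivAt
  have h1 : deriv (fun y => (s y : ℂ) * deriv f.1 y + r y * f.1 y) x = _ :=
    (((hasDerivAt_of_contDiffOn hU hs hx).ofReal_comp.mul hf').add
      ((hasDerivAt_of_contDiffOn hU hr hx).ofReal_comp.mul hf)).deriv
  simp only [firstOrderAdj, firstOrder, LinearMap.coe_mk, AddHom.coe_mk, h1]
  push_cast
  ring

lemma firstOrder_comp_adj_apply (hU : IsOpen U) {s r : ℝ → ℝ}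
    (hs : ContDiffOn ℝ (⊤ : ℕ∞) s U) (hr : ContDiffOn ℝ (⊤ : ℕ∞) r U) (f : testSpace U) {x : ℝ}
    (hx : x ∈ U) : (firstOrder hU hs hr (firstOrderAdj hU hs hr f)).1 x
      = -(s x ^ 2 : ℝ) * deriv (deriv f.1) x - (2 * s x * deriv s x : ℝ) * deriv f.1 x
        + (r x ^ 2 - r x * deriv s x + s x * deriv r x - s x * deriv (deriv s) x : ℝ)
          * f.1 x := by
  have hf := (f.2.differentiable x).hasDerivAt
  have hf' := (f.2.hasTestDeriv.differentiable x).hasDerivAt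
  have hs' := hasDerivAt_of_contDiffOn hU hs hx
  have hs'' := hasDerivAt_of_contDiffOn hU (contDiffOn_deriv_of_isOpen hU hs) hx
  have h1 : deriv (fun y => ((-s y : ℝ) : ℂ) * deriv f.1 y
      + ((r y - deriv s y : ℝ) : ℂ) * f.1 y) x = _ :=
    ((hs'.neg.ofReal_comp.mul hf').add
      (((hasDerivAt_of_contDiffOn hU hr hx).sub hs'').ofReal_comp.mul hf)).deriv
  simp only [firstOrderAdj, firstOrder, LinearMap.coe_mk, AddHom.coe_mk, h1]
  simp only [Pi.neg_apply, Pi.sub_apply]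
  push_cast
  ring

lemma IsTest.memLp {f : ℝ → ℂ} (hf : IsTest U f) : MemLp f 2 (volume.restrict Ω) :=
  hf.smooth.continuous.memLp_of_hasCompactSupport hf.compact

/-- Test functions as elements of `L²(Ω)`. -/
noncomputable def embed (U Ω : Set ℝ) : testSpace U →ₗ[ℂ] L2 Ω where
  toFun f := MemLp.toLp f.1 f.2.memLp
  map_add' _ _ := rfl
  map_smul' _ _ := rfl

lemma coeFn_embed (f : testSpace U) : embed U Ω f =ᵐ[volume.restrict Ω] f.1 :=
  f.2.memLp.coeFn_toLp

lemma inner_embed (hUΩ : U ⊆ Ω) {u : L2 Ω} {e : ℝ → ℂ} (hu : u =ᵐ[volume.restrict Ω] e)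
    (g : testSpace U) : inner ℂ u (embed U Ω g) = ∫ x, conj (e x) * g.1 x := by
  rw [L2.inner_def]
  refine Eq.trans ?_ (setIntegral_eq_integral_of_forall_compl_eq_zero (s := Ω) ?_)
  · refine integral_congr_ae ?_
    filter_upwards [hu, coeFn_embed (Ω := Ω) g] with x h1 h2
    rw [h1, h2]
    simp [RCLike.inner_apply, mul_comm]
  · intro x hx
    rw [g.2.eq_zero fun h => hx (hUΩ h), mul_zero]

lemma inner_firstOrderAdj (hU : IsOpen U) (hUΩ : U ⊆ Ω) {s r : ℝ → ℝ}
    (hs : ContDiffOn ℝ (⊤ : ℕ∞) s U) (hr : ContDiffOn ℝ (⊤ : ℕ∞) r U) {u : L2 Ω} {e : ℝ → ℂ}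
    (hu : u =ᵐ[volume.restrict Ω] e) (he : ContDiffOn ℝ (⊤ : ℕ∞) e U) {v : L2 Ω} {k : ℝ → ℂ}
    (hv : v =ᵐ[volume.restrict Ω] k) (hek : ∀ x ∈ U, s x * deriv e x + r x * e x = k x)
    (h : testSpace U) :
    inner ℂ u (embed U Ω (firstOrderAdj hU hs hr h)) = inner ℂ v (embed U Ω h) := by
  rw [inner_embed hUΩ hu, inner_embed hUΩ hv, integral_conj_mul_firstOrderAdj hU hs hr he]
  refine integral_congr_ae (Eventually.of_forall fun x => ?_)
  by_cases hx : x ∈ U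
  · simp only [hek x hx]
  · simp only [h.2.eq_zero hx, mul_zero]

lemma formalAdjointOn_firstOrder (hU : IsOpen U) (hUΩ : U ⊆ Ω) {s r : ℝ → ℝ}
    (hs : ContDiffOn ℝ (⊤ : ℕ∞) s U) (hr : ContDiffOn ℝ (⊤ : ℕ∞) r U) :
    FormalAdjointOn (embed U Ω) (firstOrder hU hs hr) (firstOrderAdj hU hs hr) := fun f g =>
  (inner_firstOrderAdj hU hUΩ hs hr (coeFn_embed f) f.2.smooth.contDiffOn (coeFn_embed _)
    (fun _ _ => rfl) g).symm

/-- The quadratic form of a test function supported away from the singular points. -/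
lemma form_eq_integral (hU : IsOpen U) (hUΩ : U ⊆ Ω) {φ V : ℝ → ℝ}
    (hφ : ContDiffOn ℝ (⊤ : ℕ∞) φ U) {f w : testSpace U}
    (hw : ∀ x ∈ U, w.1 x = -(φ x ^ 2 : ℝ) * deriv (deriv f.1) x
      - (2 * φ x * deriv φ x : ℝ) * deriv f.1 x
        + (V x - φ x * deriv (deriv φ) x : ℝ) * f.1 x) {g : ℝ → ℂ} (hg : IsTest Ω g) :
    form φ V Ω f.1 g = ∫ x in Ω, w.1 x * conj (g x) := by
  have hF := f.2.real_mul hU hφ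
  have hG : ContDiffOn ℝ (⊤ : ℕ∞) (fun x => conj ((φ x : ℂ) * g x)) U :=
    contDiffOn_conj ((contDiffOn_ofReal hφ).mul hg.smooth.contDiffOn)
  -- Only φ f needs compact support in U, so g may be supported across ± L.
  have h1 := integral_mul_deriv_isTest hU hG hF.hasTestDeriv
  have hd : ∀ x, deriv (fun y => conj ((φ y : ℂ) * g y)) x
      = conj (deriv (fun y => (φ y : ℂ) * g y) x) := fun x =>
    deriv.star
  have hF2 : ∀ x ∈ U, deriv (deriv fun y => (φ y : ℂ) * f.1 y) x
      = (deriv (deriv φ) x : ℝ) * f.1 x + 2 * (deriv φ x : ℝ) * deriv f.1 x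
        + φ x * deriv (deriv f.1) x := by
    intro x hx
    have hf := (f.2.differentiable x).hasDerivAt
    have hf' := (f.2.hasTestDeriv.differentiable x).hasDerivAt
    have e1 : (deriv fun y => (φ y : ℂ) * f.1 y) =ᶠ[𝓝 x]
        fun y => (deriv φ y : ℝ) * f.1 y + φ y * deriv f.1 y := by
      filter_upwards [hU.mem_nhds hx] with y hy
      exact ((hasDerivAt_of_contDiffOn hU hφ hy).ofReal_comp.mul
        (f.2.differentiable y).hasDerivAt).deriv
    rw [e1.deriv_eq]
    refine (HasDerivAt.deriv (((hasDerivAt_of_contDiffOn hU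
      (contDiffOn_deriv_of_isOpen hU hφ) hx).ofReal_comp.mul hf).add
      ((hasDerivAt_of_contDiffOn hU hφ hx).ofReal_comp.mul hf'))).trans ?_
    ring
  have r1 : ∫ x in Ω, deriv (fun y => (φ y : ℂ) * f.1 y) x
      * conj (deriv (fun y => (φ y : ℂ) * g y) x)
      = ∫ x, deriv (fun y => conj ((φ y : ℂ) * g y)) x * deriv (fun y => (φ y : ℂ) * f.1 y) x := by
    rw [setIntegral_eq_integral_of_forall_compl_eq_zero]
    · refine integral_congr_ae (Eventually.of_forall fun x => ?_)
      simp only [hd]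
      ring
    · intro x hx
      rw [hF.hasTestDeriv.eq_zero fun h => hx (hUΩ h), zero_mul]
  have hgc : ContDiffOn ℝ (⊤ : ℕ∞) (fun x => conj (g x)) U :=
    contDiffOn_conj hg.smooth.contDiffOn
  have i1 := (w.2.mul_left hU hgc).integrable
  have i2 := (hF.hasTestDeriv.hasTestDeriv.mul_left hU hG).integrable
  rw [form, r1, setIntegral_eq_integral_of_forall_compl_eq_zero,
    setIntegral_eq_integral_of_forall_compl_eq_zero]
  · have e3 : ∀ x, (V x : ℂ) * f.1 x * conj (g x) = conj (g x) * w.1 x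
        + conj ((φ x : ℂ) * g x) * deriv (deriv fun y => (φ y : ℂ) * f.1 y) x := by
      intro x
      by_cases hx : x ∈ U
      · rw [hw x hx, hF2 x hx]
        simp only [map_mul, Complex.conj_ofReal]
        push_cast
        ring
      · rw [f.2.eq_zero hx, w.2.eq_zero hx, hF.hasTestDeriv.hasTestDeriv.eq_zero hx]
        simp
    simp_rw [e3]
    rw [integral_add i1 i2, h1]
    simp_rw [mul_comm (w.1 _)]
    ring
  · intro x hx
    rw [w.2.eq_zero fun h => hx (hUΩ h), zero_mul]
  · intro x hx
    rw [f.2.eq_zero fun h => hx (hUΩ h), mul_zero, zero_mul]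

end Operators

end Compacton

/-! ### Factorizations of H₊ and H₋ away from the endpoints ± L. -/

namespace Compacton

section Punctured

open Set Filter Topology

variable {L : ℝ} {Ω : Set ℝ}

/-- `Ω` without the endpoints `± L` of the support of the compacton. -/
def punctured (L : ℝ) (Ω : Set ℝ) : Set ℝ := Ω \ {-L, L}

lemma isOpen_punctured (hΩ : IsOpen Ω) : IsOpen (punctured L Ω) :=
  hΩ.sdiff (toFinite _).isClosed

lemma punctured_subset : punctured L Ω ⊆ Ω := sdiff_subset

lemma Ioo_subset_punctured (hI : Ioo (-L) L ⊆ Ω) : Ioo (-L) L ⊆ punctured L Ω := by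
  intro x hx
  refine ⟨hI hx, ?_⟩
  rintro (rfl | rfl)
  · exact lt_irrefl _ hx.1
  · exact lt_irrefl _ hx.2

lemma notMem_Icc_of_mem_punctured {x : ℝ} (hx : x ∈ punctured L Ω) (hxI : x ∉ Ioo (-L) L) :
    x ∉ Icc (-L) L := fun h =>
  hxI ⟨lt_of_le_of_ne h.1 fun h' => hx.2 (Or.inl h'.symm),
    lt_of_le_of_ne h.2 fun h' => hx.2 (Or.inr h')⟩

lemma contDiffOn_punctured {F : Type*} [NormedAddCommGroup F] [NormedSpace ℝ F] {a : ℝ → F} {c : F}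
    (h1 : ContDiffOn ℝ (⊤ : ℕ∞) a (Ioo (-L) L)) (h2 : ∀ x ∉ Icc (-L) L, a x = c) :
    ContDiffOn ℝ (⊤ : ℕ∞) a (punctured L Ω) := by
  intro x hx
  refine ContDiffAt.contDiffWithinAt ?_
  by_cases hxI : x ∈ Ioo (-L) L
  · exact h1.contDiffAt (isOpen_Ioo.mem_nhds hxI)
  · have : a =ᶠ[𝓝 x] fun _ => c := by
      filter_upwards [isClosed_Icc.isOpen_compl.mem_nhds (notMem_Icc_of_mem_punctured hx hxI)]
        with y hy using h2 y hy
    exact contDiffAt_const.congr_of_eventuallyEq this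

lemma ae_restrict_of_punctured {P : ℝ → Prop} (hΩ : IsOpen Ω)
    (h1 : ∀ᵐ x, x ∈ Ioo (-L) L → P x) (h2 : ∀ᵐ x, x ∈ Ω \ Icc (-L) L → P x) :
    ∀ᵐ x ∂volume.restrict Ω, P x := by
  rw [ae_restrict_iff' hΩ.measurableSet]
  have h3 : ∀ᵐ x : ℝ, x ∉ ({-L, L} : Set ℝ) :=
    (toFinite ({-L, L} : Set ℝ)).countable.ae_notMem _
  filter_upwards [h1, h2, h3] with x h1 h2 h3 hx
  by_cases hxI : x ∈ Ioo (-L) L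
  · exact h1 hxI
  · exact h2 ⟨hx, notMem_Icc_of_mem_punctured ⟨hx, h3⟩ hxI⟩

/-- The zeroth-order coefficient of the factors of `H_±`. -/
noncomputable def factorCoeff (L : ℝ) (φ : ℝ → ℝ) (a c x : ℝ) : ℝ :=
  -a * deriv φ x + c * indicator (Icc (-L) L)ᶜ 1 x

lemma factorCoeff_of_mem {φ : ℝ → ℝ} {a c x : ℝ} (hx : x ∈ Ioo (-L) L) :
    factorCoeff L φ a c x = -a * deriv φ x := by
  have : x ∉ (Icc (-L) L)ᶜ := fun h => h (Ioo_subset_Icc_self hx)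
  simp [factorCoeff, indicator_of_notMem this]

/-- The function `φ ^ a` on `(-L, L)`, extended by zero. -/
noncomputable def powIndicator (L : ℝ) (φ : ℝ → ℝ) (a : ℝ) : ℝ → ℝ :=
  indicator (Ioo (-L) L) fun x => φ x ^ a

end Punctured

namespace IsCompacton

open Set Filter Topology

variable {p ω L : ℝ} {φ : ℝ → ℝ} {Ω : Set ℝ} (hφ : IsCompacton p ω L φ)
include hφ

lemma contDiffOn_pow (hp : 2 < p) (a : ℝ) :
    ContDiffOn ℝ (⊤ : ℕ∞) (fun x => φ x ^ a) (Ioo (-L) L) :=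
  (hφ.contDiffOn_top hp).rpow_const_of_ne fun _ hx => (hφ.pos hx).ne'

lemma hasDerivAt_pow (a : ℝ) {x : ℝ} (hx : x ∈ Ioo (-L) L) :
    HasDerivAt (fun y => φ y ^ a) (a * deriv φ x * φ x ^ (a - 1)) x := by
  have := (hφ.hasDerivAt hx).rpow_const (p := a) (Or.inl (hφ.pos hx).ne')
  rwa [mul_comm (deriv φ x)] at this

lemma mul_pow_sub_one (a : ℝ) {x : ℝ} (hx : x ∈ Ioo (-L) L) :
    φ x * φ x ^ (a - 1) = φ x ^ a := by
  rw [mul_comm, ← Real.rpow_add_one (hφ.pos hx).ne', sub_add_cancel]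

lemma contDiffOn_puncturedSet (hp : 2 < p) :
    ContDiffOn ℝ (⊤ : ℕ∞) φ (punctured L Ω) :=
  contDiffOn_punctured (hφ.contDiffOn_top hp) fun _ hx => hφ.eq_zero fun h =>
    hx (Ioo_subset_Icc_self h)

lemma factorCoeff_of_notMem {a c x : ℝ} (hx : x ∉ Icc (-L) L) : factorCoeff L φ a c x = c := by
  have : x ∈ (Icc (-L) L)ᶜ := hx
  simp [factorCoeff, indicator_of_mem this, hφ.deriv_eq_zero hx]

lemma contDiffOn_factorCoeff (hp : 2 < p) (a c : ℝ) :
    ContDiffOn ℝ (⊤ : ℕ∞) (factorCoeff L φ a c) (punctured L Ω) := by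
  refine contDiffOn_punctured (c := c) ?_ fun x hx => hφ.factorCoeff_of_notMem hx
  have h := contDiffOn_deriv_of_isOpen isOpen_Ioo (hφ.contDiffOn_top hp)
  exact (contDiffOn_const.mul h).congr fun x hx => factorCoeff_of_mem hx

omit hφ in
lemma deriv_factorCoeff_of_mem {a c x : ℝ} (hx : x ∈ Ioo (-L) L) :
    deriv (factorCoeff L φ a c) x = -a * deriv (deriv φ) x := by
  have : factorCoeff L φ a c =ᶠ[𝓝 x] fun y => -a * deriv φ y := by
    filter_upwards [isOpen_Ioo.mem_nhds hx] with y hy using factorCoeff_of_mem hy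
  rw [this.deriv_eq, deriv_const_mul_field]

/-- The first-order factor `f ↦ φ f' - a φ' f + c 1_{ℝ ∖ [-L, L]} f`. -/
noncomputable def factor (hp : 2 < p) (hΩ : IsOpen Ω) (a c : ℝ) :
    testSpace (punctured L Ω) →ₗ[ℂ] testSpace (punctured L Ω) :=
  firstOrder (isOpen_punctured hΩ) (hφ.contDiffOn_puncturedSet hp)
    (hφ.contDiffOn_factorCoeff hp a c)

/-- The formal adjoint of `factor`. -/
noncomputable def factorAdj (hp : 2 < p) (hΩ : IsOpen Ω) (a c : ℝ) :
    testSpace (punctured L Ω) →ₗ[ℂ] testSpace (punctured L Ω) :=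
  firstOrderAdj (isOpen_punctured hΩ) (hφ.contDiffOn_puncturedSet hp)
    (hφ.contDiffOn_factorCoeff hp a c)

lemma formalAdjointOn_factor (hp : 2 < p) (hΩ : IsOpen Ω) (a c : ℝ) :
    FormalAdjointOn (embed (punctured L Ω) Ω) (hφ.factor hp hΩ a c) (hφ.factorAdj hp hΩ a c) :=
  formalAdjointOn_firstOrder _ punctured_subset _ _

/-- `D' D` has the form `-φ ∂² (φ f) + (V + m) f`. -/
lemma factorAdj_factor_apply (hp : 2 < p) (hΩ : IsOpen Ω) {a c m α β : ℝ} {V : ℝ → ℝ}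
    (hV : ∀ x ∈ Ioo (-L) L, V x = α + β * φ x ^ (p - 2)) (hV' : ∀ x ∉ Icc (-L) L, V x = ω)
    (hα : a * (a + 1) * ω - m = α) (hβ : -((a + 1) * (2 * a + p - 2) / p) = β)
    (hc : c ^ 2 = ω + m) (f : testSpace (punctured L Ω)) {x : ℝ} (hx : x ∈ punctured L Ω) :
    (hφ.factorAdj hp hΩ a c (hφ.factor hp hΩ a c f)).1 x
      = -(φ x ^ 2 : ℝ) * deriv (deriv f.1) x - (2 * φ x * deriv φ x : ℝ) * deriv f.1 x
        + (V x - φ x * deriv (deriv φ) x + m : ℝ) * f.1 x := by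
  have hp0 : p ≠ 0 := by linarith
  rw [factorAdj, factor, firstOrderAdj_comp_apply _ _ _ _ hx]
  congr 3
  -- Inside, the zeroth-order coefficient a(a+1) φ'² + a φ φ'' is rewritten by the two profile
  -- identities; outside, only c² = ω + m remains.
  by_cases hxI : x ∈ Ioo (-L) L
  · rw [factorCoeff_of_mem hxI, deriv_factorCoeff_of_mem hxI, hV x hxI]
    have h1 := hφ.sq_deriv hp hxI
    have h2 := hφ.mul_deriv_deriv hp hxI
    rw [← hα, ← hβ]
    field_simp at h1 h2 ⊢
    linear_combination (a ^ 2 + a) * h1 + (a + 1) * h2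
  · have hx' := notMem_Icc_of_mem_punctured hx hxI
    rw [hφ.factorCoeff_of_notMem hx', hφ.deriv_eq_zero hx', hφ.eq_zero hxI, hV' x hx']
    linear_combination hc

/-- Two factorizations of the same operator. -/
lemma factorAdj_factor_eq (hp : 2 < p) (hΩ : IsOpen Ω) {a c m a' c' m' α β : ℝ} {V : ℝ → ℝ}
    (hV : ∀ x ∈ Ioo (-L) L, V x = α + β * φ x ^ (p - 2)) (hV' : ∀ x ∉ Icc (-L) L, V x = ω)
    (hα : a * (a + 1) * ω - m = α) (hβ : -((a + 1) * (2 * a + p - 2) / p) = β)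
    (hc : c ^ 2 = ω + m)
    (hα' : a' * (a' + 1) * ω - m' = α) (hβ' : -((a' + 1) * (2 * a' + p - 2) / p) = β)
    (hc' : c' ^ 2 = ω + m') (f : testSpace (punctured L Ω)) :
    hφ.factorAdj hp hΩ a c (hφ.factor hp hΩ a c f) - (m : ℂ) • f
      = hφ.factorAdj hp hΩ a' c' (hφ.factor hp hΩ a' c' f) - (m' : ℂ) • f := by
  ext x
  simp only [AddSubgroupClass.coe_sub, SetLike.val_smul, Pi.sub_apply, Pi.smul_apply, smul_eq_mul]
  by_cases hx : x ∈ punctured L Ω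
  · rw [hφ.factorAdj_factor_apply hp hΩ hV hV' hα hβ hc f hx,
      hφ.factorAdj_factor_apply hp hΩ hV hV' hα' hβ' hc' f hx]
    push_cast
    ring
  · rw [f.2.eq_zero hx, (hφ.factorAdj hp hΩ a c _).2.eq_zero hx,
      (hφ.factorAdj hp hΩ a' c' _).2.eq_zero hx]
    simp

lemma mem_symmGraph (hp : 2 < p) (hΩ : IsOpen Ω) {a c m α β : ℝ} {V : ℝ → ℝ}
    (hV : ∀ x ∈ Ioo (-L) L, V x = α + β * φ x ^ (p - 2)) (hV' : ∀ x ∉ Icc (-L) L, V x = ω)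
    (hα : a * (a + 1) * ω - m = α) (hβ : -((a + 1) * (2 * a + p - 2) / p) = β)
    (hc : c ^ 2 = ω + m) (f : testSpace (punctured L Ω)) :
    (embed (punctured L Ω) Ω f, embed (punctured L Ω) Ω
      (hφ.factorAdj hp hΩ a c (hφ.factor hp hΩ a c f) - (m : ℂ) • f)) ∈ symmGraph φ V Ω := by
  refine ⟨f.1, f.2.mono punctured_subset, coeFn_embed f, fun g hg => ?_⟩
  rw [form_eq_integral (isOpen_punctured hΩ) punctured_subset (hφ.contDiffOn_puncturedSet hp)
    (w := hφ.factorAdj hp hΩ a c (hφ.factor hp hΩ a c f) - (m : ℂ) • f) ?_ hg]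
  · refine integral_congr_ae ?_
    filter_upwards [coeFn_embed (Ω := Ω)
      (hφ.factorAdj hp hΩ a c (hφ.factor hp hΩ a c f) - (m : ℂ) • f)] with x hx
    rw [hx]
  · intro x hx
    simp only [AddSubgroupClass.coe_sub, SetLike.val_smul, Pi.sub_apply, Pi.smul_apply,
      smul_eq_mul]
    rw [hφ.factorAdj_factor_apply hp hΩ hV hV' hα hβ hc f hx]
    push_cast
    ring

/-- The spectral gap identity `D D' = K' K + m` for `H₊`. -/
lemma factor_factorAdj_eq (hp : 2 < p) (hΩ : IsOpen Ω) {c k m : ℝ}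
    (hm : m = ω * p * (p - 2) / 4) (hc : c ^ 2 = ω + m) (hk : k ^ 2 = ω)
    (f : testSpace (punctured L Ω)) :
    hφ.factor hp hΩ ((p - 2) / 2) c (hφ.factorAdj hp hΩ ((p - 2) / 2) c f)
      = hφ.factorAdj hp hΩ 0 k (hφ.factor hp hΩ 0 k f) + (m : ℂ) • f := by
  have hp0 : p ≠ 0 := by linarith
  ext x
  simp only [Submodule.coe_add, SetLike.val_smul, Pi.add_apply, Pi.smul_apply, smul_eq_mul]
  by_cases hx : x ∈ punctured L Ω
  · rw [factorAdj, factor, factorAdj, factor, firstOrderAdj_comp_apply _ _ _ _ hx,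
      firstOrder_comp_adj_apply _ _ _ _ hx]
    rw [add_assoc, ← add_mul, ← Complex.ofReal_add]
    congr 3
    -- The coefficient of D D' is (a+1)(a φ'² - φ φ''), that of K' K is 0. For a = (p-2)/2 the
    -- powers of φ cancel and leave the constant (p/2)((p-2)/2) ω = m.
    by_cases hxI : x ∈ Ioo (-L) L
    · rw [factorCoeff_of_mem hxI, deriv_factorCoeff_of_mem hxI, factorCoeff_of_mem hxI,
        deriv_factorCoeff_of_mem hxI, hm]
      have h1 := hφ.sq_deriv hp hxI
      have h2 := hφ.mul_deriv_deriv hp hxI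
      field_simp at h1 h2 ⊢
      linear_combination (4 * (p - 2)) * h1 - 8 * h2
    · have hx' := notMem_Icc_of_mem_punctured hx hxI
      rw [hφ.factorCoeff_of_notMem hx', hφ.factorCoeff_of_notMem hx', hφ.deriv_eq_zero hx',
        hφ.eq_zero hxI]
      linear_combination hc - hk
  · rw [f.2.eq_zero hx, (hφ.factorAdj hp hΩ _ _ _).2.eq_zero hx,
      (hφ.factor hp hΩ _ _ _).2.eq_zero hx]
    simp

lemma contDiffOn_powIndicator (hp : 2 < p) (a : ℝ) :
    ContDiffOn ℝ (⊤ : ℕ∞) (powIndicator L φ a) (punctured L Ω) :=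
  contDiffOn_punctured (c := 0)
    ((hφ.contDiffOn_pow hp a).congr fun _ hx => indicator_of_mem hx _)
    fun _ hx => indicator_of_notMem (fun h => hx (Ioo_subset_Icc_self h)) _

omit hφ in
lemma powIndicator_of_mem {a x : ℝ} (hx : x ∈ Ioo (-L) L) : powIndicator L φ a x = φ x ^ a :=
  indicator_of_mem hx _

omit hφ in
lemma powIndicator_of_notMem {a x : ℝ} (hx : x ∉ Ioo (-L) L) : powIndicator L φ a x = 0 :=
  indicator_of_notMem hx _

lemma deriv_powIndicator {a x : ℝ} (hx : x ∈ Ioo (-L) L) :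
    deriv (fun y => (powIndicator L φ a y : ℂ)) x
      = ((a * deriv φ x * φ x ^ (a - 1) : ℝ) : ℂ) := by
  refine HasDerivAt.deriv (HasDerivAt.ofReal_comp ?_)
  refine (hφ.hasDerivAt_pow a hx).congr_of_eventuallyEq ?_
  filter_upwards [isOpen_Ioo.mem_nhds hx] with y hy using powIndicator_of_mem hy

omit hφ in
lemma deriv_powIndicator_of_notMem {a x : ℝ} (hx : x ∉ Icc (-L) L) :
    deriv (fun y => (powIndicator L φ a y : ℂ)) x = 0 := by
  have : (fun y => (powIndicator L φ a y : ℂ)) =ᶠ[𝓝 x] fun _ => 0 := by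
    filter_upwards [isClosed_Icc.isOpen_compl.mem_nhds hx] with y hy
    rw [powIndicator_of_notMem fun h => hy (Ioo_subset_Icc_self h), Complex.ofReal_zero]
  rw [this.deriv_eq, deriv_const]

lemma memLp_powIndicator {a : ℝ} (ha : 0 ≤ a) :
    MemLp (fun x => (powIndicator L φ a x : ℂ)) 2 (volume.restrict Ω) := by
  have hc : Continuous fun x => ((φ x ^ a : ℝ) : ℂ) :=
    Complex.continuous_ofReal.comp (hφ.continuous.rpow_const fun _ => Or.inr ha)
  have e : (fun x => (powIndicator L φ a x : ℂ))
      = indicator (Ioo (-L) L) fun x => ((φ x ^ a : ℝ) : ℂ) := by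
    ext x
    by_cases hx : x ∈ Ioo (-L) L
    · rw [indicator_of_mem hx, powIndicator_of_mem hx]
    · rw [indicator_of_notMem hx, powIndicator_of_notMem hx, Complex.ofReal_zero]
  rw [e, memLp_indicator_iff_restrict measurableSet_Ioo]
  refine MemLp.mono_measure (μ := volume.restrict (Ioo (-L) L)) ?_ ?_
  · exact Measure.restrict_mono le_rfl Measure.restrict_le_self
  obtain ⟨C, hC⟩ := (isCompact_Icc (a := -L) (b := L)).exists_bound_of_continuousOn hc.continuousOn
  refine MemLp.of_bound hc.aestronglyMeasurable C ?_
  rw [ae_restrict_iff' measurableSet_Ioo]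
  exact Eventually.of_forall fun x hx => hC x (Ioo_subset_Icc_self hx)

/-- `φ ^ a` is annihilated by the factor with exponent `a`. -/
lemma inner_powIndicator_factorAdj (hp : 2 < p) (hΩ : IsOpen Ω) {a c : ℝ} {v : L2 Ω}
    (hv : v =ᵐ[volume.restrict Ω] fun x => (powIndicator L φ a x : ℂ))
    (h : testSpace (punctured L Ω)) :
    inner ℂ v (embed (punctured L Ω) Ω (hφ.factorAdj hp hΩ a c h)) = 0 := by
  rw [← inner_zero_left (embed (punctured L Ω) Ω h)]
  refine inner_firstOrderAdj _ punctured_subset _ _ hv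
    (contDiffOn_ofReal (hφ.contDiffOn_powIndicator hp a)) (Lp.coeFn_zero _ _ _) (fun x hx => ?_) h
  by_cases hxI : x ∈ Ioo (-L) L
  · rw [hφ.deriv_powIndicator hxI, factorCoeff_of_mem hxI, powIndicator_of_mem hxI,
      ← hφ.mul_pow_sub_one a hxI]
    push_cast
    simp only [Pi.zero_apply]
    ring
  · rw [deriv_powIndicator_of_notMem (notMem_Icc_of_mem_punctured hx hxI),
      powIndicator_of_notMem hxI]
    simp

lemma ne_zero_of_ae_eq_powIndicator (hI : Ioo (-L) L ⊆ Ω) {a : ℝ} {v : L2 Ω}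
    (hp : 2 < p) (hv : v =ᵐ[volume.restrict Ω] fun x => (powIndicator L φ a x : ℂ)) : v ≠ 0 := by
  rintro rfl
  obtain ⟨g, hg, hg1⟩ := exists_isTest_integral_ne_zero (by linarith [hφ.L_pos] : -L < L)
    (hφ.contDiffOn_pow hp a).continuousOn fun x hx => Real.rpow_pos_of_pos (hφ.pos hx) a
  have h1 := inner_embed punctured_subset hv (⟨g, hg.mono (Ioo_subset_punctured hI)⟩ :
    testSpace (punctured L Ω))
  rw [inner_zero_left] at h1
  refine one_ne_zero (hg1.symm.trans (Eq.trans ?_ h1.symm))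
  refine integral_congr_ae (Eventually.of_forall fun x => ?_)
  by_cases hx : x ∈ Ioo (-L) L
  · simp only [powIndicator_of_mem hx, Complex.conj_ofReal]
  · simp only [hg.eq_zero hx, mul_zero]

end IsCompacton

end Compacton

/-! ### Kernels of the adjoint factors and the limit-point property. -/

namespace Compacton

open Set Filter Topology

lemma locallyIntegrableOn_conj {Ω U : Set ℝ} (hU : U ⊆ Ω) (u : L2 Ω) :
    LocallyIntegrableOn (fun x => conj (u x)) U := by
  have h1 : LocallyIntegrable (fun x => u x) (volume.restrict Ω) :=
    (Lp.memLp u).locallyIntegrable (by norm_num)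
  have h2 : LocallyIntegrable (fun x => conj (u x)) (volume.restrict Ω) := fun x => by
    obtain ⟨s, hs, hi⟩ := h1 x
    exact ⟨s, hs, (LinearIsometryEquiv.integrable_comp_iff Complex.conjLIE).2 hi⟩
  exact (locallyIntegrableOn_of_locallyIntegrable_restrict h2).mono_set hU

/-- A function that is comparable with `φ ^ a`, `2 a ≤ -1`, near a zero of a Lipschitz function `φ`
is not square integrable. -/
lemma not_integrableOn_sq_of_pow {α β e C δ a : ℝ} {φ : ℝ → ℝ} {u B : ℝ → ℂ} (hαβ : α < β)
    (he : e ∈ Icc α β) (hC : 0 < C) (hδ : 0 < δ) (ha : 2 * a ≤ -1)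
    (hpos : ∀ x ∈ Ioo α β, 0 < φ x) (hle : ∀ x ∈ Ioo α β, φ x ≤ C * |x - e|)
    (hle1 : ∀ x ∈ Ioo α β, φ x ≤ 1) (hB : ∀ x ∈ Ioo α β, δ ≤ ‖B x‖)
    (hu : ∀ᵐ x, x ∈ Ioo α β → u x = B x * (φ x ^ a : ℝ))
    (hi : IntegrableOn (fun x => ‖u x‖ ^ 2) (Ioo α β)) : False := by
  have h1 : IntegrableOn (fun x => (x - e)⁻¹) (Ioo α β) := by
    -- As φ ≤ 1 and 2a ≤ -1, one has φ^(2a) ≥ φ⁻¹ ≥ (C |x - e|)⁻¹, so integrability of |u|² would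
    -- make 1/(x - e) integrable up to its pole.
    refine (hi.const_mul (C * (δ ^ 2)⁻¹)).mono' (by fun_prop) ?_
    rw [ae_restrict_iff' measurableSet_Ioo]
    filter_upwards [hu] with x hx hxI
    have hφ := hpos x hxI
    have h2 : (φ x)⁻¹ ≤ (φ x ^ a) ^ 2 := by
      rw [← Real.rpow_natCast, ← Real.rpow_mul hφ.le, ← Real.rpow_neg_one]
      exact Real.rpow_le_rpow_of_exponent_ge hφ (hle1 x hxI) (by push_cast; linarith)
    have h3 : |x - e|⁻¹ ≤ C * (φ x)⁻¹ := by
      have h4 : 0 < |x - e| := by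
        by_contra hc
        nlinarith [hle x hxI, abs_nonneg (x - e)]
      rw [inv_le_iff_one_le_mul₀ h4, mul_assoc, mul_comm (φ x)⁻¹, ← mul_assoc,
        ← div_eq_mul_inv, one_le_div hφ]
      exact hle x hxI
    rw [hx hxI, norm_mul, Complex.norm_real, norm_inv, Real.norm_eq_abs, Real.norm_eq_abs,
      mul_pow, sq_abs]
    calc |x - e|⁻¹ ≤ C * (φ x)⁻¹ := h3
      _ ≤ C * (φ x ^ a) ^ 2 := by gcongr
      _ = C * (δ ^ 2)⁻¹ * (δ ^ 2 * (φ x ^ a) ^ 2) := by field_simp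
      _ ≤ _ := by gcongr; exact hB x hxI
  have h5 : IntervalIntegrable (fun x => (x - e)⁻¹) volume α β :=
    (intervalIntegrable_iff_integrableOn_Ioo_of_le hαβ.le).2 h1
  rw [intervalIntegrable_sub_inv_iff, uIcc_of_le hαβ.le] at h5
  exact h5.elim hαβ.ne fun h => h he

namespace IsCompacton

variable {p ω L : ℝ} {φ : ℝ → ℝ} {Ω : Set ℝ} (hφ : IsCompacton p ω L φ)
include hφ

lemma le_sqrt_mul_left (hp : 2 < p) {x : ℝ} (hx : x ∈ Ioo (-L) L) :
    φ x ≤ Real.sqrt ω * (x + L) := by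
  have := hφ.le_sqrt_mul hp (x := -x) ⟨by linarith [hx.2], by linarith [hx.1]⟩
  rw [hφ.even] at this
  linarith

/-- If B e were nonzero, |u| would be bounded below by a multiple of φ^a on a one-sided
neighbourhood of e, contradicting square integrability since φ ≤ √ω |x - e|. -/
lemma eq_zero_of_ae_eq_mul_pow (hp : 2 < p) (hω : 0 < ω) {a : ℝ} (ha : 2 * a ≤ -1) {u B : ℝ → ℂ}
    {e : ℝ} (he : e = L ∨ e = -L) (hB : ContinuousAt B e)
    (hu : ∀ᵐ x, x ∈ Ioo (-L) L → u x = B x * (φ x ^ a : ℝ))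
    (hi : IntegrableOn (fun x => ‖u x‖ ^ 2) (Ioo (-L) L)) : B e = 0 := by
  by_contra hne
  have hL := hφ.L_pos
  have hδ : 0 < ‖B e‖ / 2 := by positivity
  have hφe : φ e = 0 := hφ.eq_zero (by rcases he with rfl | rfl <;> simp)
  have ev : ∀ᶠ x in 𝓝 e, ‖B e‖ / 2 ≤ ‖B x‖ ∧ φ x ≤ 1 := by
    have e1 : ∀ᶠ x in 𝓝 e, ‖B e‖ / 2 < ‖B x‖ :=
      hB.norm.eventually (lt_mem_nhds (by linarith))
    have e2 : ∀ᶠ x in 𝓝 e, φ x < 1 :=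
      hφ.continuous.continuousAt.eventually (gt_mem_nhds (by rw [hφe]; exact one_pos))
    filter_upwards [e1, e2] with x h1 h2 using ⟨h1.le, h2.le⟩
  obtain ⟨η, hη, hball⟩ := Metric.eventually_nhds_iff.1 ev
  have hdist : ∀ x ∈ Ioo (-L) L, φ x ≤ Real.sqrt ω * |x - e| := by
    intro x hx
    rcases he with rfl | rfl
    · rw [abs_sub_comm, abs_of_pos (by linarith [hx.2])]
      exact hφ.le_sqrt_mul hp hx
    · rw [sub_neg_eq_add, abs_of_pos (by linarith [hx.1])]
      exact hφ.le_sqrt_mul_left hp hx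
  have key : ∀ α β, α < β → e ∈ Icc α β → Ioo α β ⊆ Ioo (-L) L → β - α ≤ η → False := by
    intro α β hαβ heI hsub hlen
    have hnear : ∀ x ∈ Ioo α β, ‖B e‖ / 2 ≤ ‖B x‖ ∧ φ x ≤ 1 := fun x hx => hball (by
      rw [Real.dist_eq, abs_lt]
      constructor <;> linarith [hx.1, hx.2, heI.1, heI.2])
    refine not_integrableOn_sq_of_pow (u := u) (B := B) hαβ heI (Real.sqrt_pos.2 hω) hδ ha
      (fun x hx => hφ.pos (hsub hx)) (fun x hx => hdist x (hsub hx))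
      (fun x hx => (hnear x hx).2) (fun x hx => (hnear x hx).1) ?_ (hi.mono_set hsub)
    filter_upwards [hu] with x hx hxI using hx (hsub hxI)
  have hm : 0 < min η L := lt_min hη hL
  have hm1 := min_le_left η L
  have hm2 := min_le_right η L
  rcases he with rfl | rfl
  · exact key (e - min η e) e (by linarith) ⟨by linarith, le_rfl⟩
      (Ioo_subset_Ioo (by linarith) le_rfl) (by linarith)
  · exact key (-L) (-L + min η L) (by linarith) ⟨le_rfl, by linarith⟩
      (Ioo_subset_Ioo le_rfl (by linarith)) (by linarith)

lemma factorAdj_apply_of_mem (hp : 2 < p) (hΩ : IsOpen Ω) (a c : ℝ)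
    (h : testSpace (punctured L Ω)) {x : ℝ} (hx : x ∈ Ioo (-L) L) :
    (hφ.factorAdj hp hΩ a c h).1 x
      = -φ x * deriv h.1 x - (a + 1) * (deriv φ x : ℝ) * h.1 x := by
  simp only [factorAdj, firstOrderAdj, firstOrder, LinearMap.coe_mk, AddHom.coe_mk,
    factorCoeff_of_mem hx]
  push_cast
  ring

lemma factor_apply_of_mem (hp : 2 < p) (hΩ : IsOpen Ω) (a c : ℝ)
    (h : testSpace (punctured L Ω)) {x : ℝ} (hx : x ∈ Ioo (-L) L) :
    (hφ.factor hp hΩ a c h).1 x = φ x * deriv h.1 x - a * (deriv φ x : ℝ) * h.1 x := by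
  simp only [factor, firstOrder, LinearMap.coe_mk, AddHom.coe_mk, factorCoeff_of_mem hx]
  push_cast
  ring

lemma factorAdj_eq_smul (hp : 2 < p) (hΩ : IsOpen Ω) (a c : ℝ)
    {g : testSpace (punctured L Ω)} (hg : IsTest (Ω \ Icc (-L) L) g.1) :
    hφ.factorAdj hp hΩ a c g = (c : ℂ) • g := by
  ext x
  simp only [factorAdj, firstOrderAdj, firstOrder, LinearMap.coe_mk, AddHom.coe_mk,
    SetLike.val_smul, Pi.smul_apply, smul_eq_mul]
  by_cases hx : x ∈ Ω \ Icc (-L) L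
  · rw [hφ.eq_zero fun h => hx.2 (Ioo_subset_Icc_self h), hφ.deriv_eq_zero hx.2,
      hφ.factorCoeff_of_notMem hx.2]
    simp
  · rw [hg.eq_zero hx, hg.hasTestDeriv.eq_zero hx]
    simp

lemma factor_eq_smul (hp : 2 < p) (hΩ : IsOpen Ω) (a c : ℝ)
    {g : testSpace (punctured L Ω)} (hg : IsTest (Ω \ Icc (-L) L) g.1) :
    hφ.factor hp hΩ a c g = (c : ℂ) • g := by
  ext x
  simp only [factor, firstOrder, LinearMap.coe_mk, AddHom.coe_mk,
    SetLike.val_smul, Pi.smul_apply, smul_eq_mul]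
  by_cases hx : x ∈ Ω \ Icc (-L) L
  · rw [hφ.eq_zero fun h => hx.2 (Ioo_subset_Icc_self h), hφ.factorCoeff_of_notMem hx.2]
    simp
  · rw [hg.eq_zero hx, hg.hasTestDeriv.eq_zero hx]
    simp

lemma diff_Icc_subset_punctured : Ω \ Icc (-L) L ⊆ punctured L Ω := by
  rintro x ⟨hx, hxI⟩
  refine ⟨hx, ?_⟩
  rintro (rfl | rfl)
  · exact hxI ⟨le_rfl, by linarith [hφ.L_pos]⟩
  · exact hxI ⟨by linarith [hφ.L_pos], le_rfl⟩

/-- Disposes of the exterior when Ω is the line: there the factors act as multiplication by c ≠ 0,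
so orthogonality to their range includes orthogonality to all exterior test functions. -/
lemma ae_eq_zero_outside (hΩ : IsOpen Ω) {u : L2 Ω}
    (h : ∀ g : testSpace (punctured L Ω), IsTest (Ω \ Icc (-L) L) g.1 →
      inner ℂ u (embed (punctured L Ω) Ω g) = 0) :
    ∀ᵐ x, x ∈ Ω \ Icc (-L) L → u x = 0 := by
  have := ae_eq_zero_of_integral_isTest (hΩ.sdiff isClosed_Icc)
    (locallyIntegrableOn_conj sdiff_subset u) fun g hg => by
      rw [← inner_embed punctured_subset (EventuallyEq.rfl)
        (⟨g, hg.mono hφ.diff_Icc_subset_punctured⟩ : testSpace (punctured L Ω))]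
      exact h _ hg
  filter_upwards [this] with x hx hxO
  simpa using hx hxO

lemma locallyIntegrableOn_conj_mul_pow (hp : 2 < p) (hI : Ioo (-L) L ⊆ Ω)
    (u : L2 Ω) (a : ℝ) :
    LocallyIntegrableOn (fun x => conj (u x) * ((φ x ^ a : ℝ) : ℂ)) (Ioo (-L) L) :=
  (locallyIntegrableOn_conj hI u).mul_continuousOn
    (contDiffOn_ofReal (hφ.contDiffOn_pow hp a)).continuousOn isOpen_Ioo.isLocallyClosed

/-- The substitution `h = φ ^ (-a - 1) l` turns `D'` into a derivative. -/
lemma inner_factorAdj_substitution (hp : 2 < p) (hΩ : IsOpen Ω) (a c : ℝ)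
    (u : L2 Ω) {l : ℝ → ℂ} (hl : IsTest (Ioo (-L) L) l) {h : testSpace (punctured L Ω)}
    (hh : ∀ x ∈ Ioo (-L) L, h.1 x = ((φ x ^ (-a - 1) : ℝ) : ℂ) * l x)
    (hh0 : ∀ x ∉ Ioo (-L) L, h.1 x = 0) :
    inner ℂ u (embed (punctured L Ω) Ω (hφ.factorAdj hp hΩ a c h))
      = -∫ x, conj (u x) * ((φ x ^ (-a) : ℝ) : ℂ) * deriv l x := by
  rw [inner_embed punctured_subset EventuallyEq.rfl, ← integral_neg]
  have hh' : h.1 = fun x => ((φ x ^ (-a - 1) : ℝ) : ℂ) * l x := by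
    ext x
    by_cases hx : x ∈ Ioo (-L) L
    · exact hh x hx
    · rw [hh0 x hx, hl.eq_zero hx, mul_zero]
  have hht : IsTest (Ioo (-L) L) h.1 := by
    rw [hh']
    exact hl.real_mul isOpen_Ioo (hφ.contDiffOn_pow hp _)
  have hae : ∀ᵐ x : ℝ, x ∉ ({-L, L} : Set ℝ) :=
    (toFinite ({-L, L} : Set ℝ)).countable.ae_notMem _
  refine integral_congr_ae ?_
  filter_upwards [hae] with x hxL
  by_cases hx : x ∈ Ioo (-L) L
  · have hd : deriv h.1 x = (((-a - 1) * deriv φ x * φ x ^ (-a - 1 - 1) : ℝ) : ℂ) * l x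
        + ((φ x ^ (-a - 1) : ℝ) : ℂ) * deriv l x := by
      rw [hh']
      exact ((hφ.hasDerivAt_pow (-a - 1) hx).ofReal_comp.mul
        (hl.differentiable x).hasDerivAt).deriv
    rw [hφ.factorAdj_apply_of_mem hp hΩ a c h hx, hd, hh x hx, ← hφ.mul_pow_sub_one (-a) hx,
      ← hφ.mul_pow_sub_one (-a - 1) hx]
    push_cast
    ring
  · have : (hφ.factorAdj hp hΩ a c h).1 x = 0 := by
      simp only [factorAdj, firstOrderAdj, firstOrder, LinearMap.coe_mk, AddHom.coe_mk]
      rw [hht.eq_zero hx, hht.hasTestDeriv.eq_zero hx]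
      simp
    rw [this, hl.hasTestDeriv.eq_zero hx]
    simp

/-- The orthogonal complement of the range of `D'` is spanned by `φ ^ a`. -/
lemma mem_span_of_inner_factorAdj (hp : 2 < p) (hΩ : IsOpen Ω) (hI : Ioo (-L) L ⊆ Ω) {a c : ℝ}
    (hc : c ≠ 0) {v : L2 Ω} (hv : v =ᵐ[volume.restrict Ω] fun x => (powIndicator L φ a x : ℂ))
    {u : L2 Ω} (hu : ∀ h : testSpace (punctured L Ω),
      inner ℂ u (embed (punctured L Ω) Ω (hφ.factorAdj hp hΩ a c h)) = 0) :
    u ∈ Submodule.span ℂ {v} := by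
  have hout := hφ.ae_eq_zero_outside hΩ (u := u) fun g hg => by
    have := hu g
    rw [hφ.factorAdj_eq_smul hp hΩ a c hg, map_smul, inner_smul_right, mul_eq_zero] at this
    exact this.resolve_left (by exact_mod_cast hc)
  obtain ⟨k, hk⟩ := ae_eq_const_of_integral_deriv (by linarith [hφ.L_pos] : -L < L)
    (hφ.locallyIntegrableOn_conj_mul_pow hp hI u (-a)) fun l hl => by
      have ht : IsTest (Ioo (-L) L) fun x => ((φ x ^ (-a - 1) : ℝ) : ℂ) * l x :=
        hl.real_mul isOpen_Ioo (hφ.contDiffOn_pow hp _)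
      have := hφ.inner_factorAdj_substitution hp hΩ a c u hl
        (h := ⟨_, ht.mono (Ioo_subset_punctured hI)⟩) (fun _ _ => rfl) fun x hx => ht.eq_zero hx
      rw [hu, eq_comm, neg_eq_zero] at this
      exact this
  rw [Submodule.mem_span_singleton]
  refine ⟨conj k, (Lp.ext ?_).symm⟩
  have key : ∀ᵐ x ∂volume.restrict Ω, u x = conj k * powIndicator L φ a x := by
    refine ae_restrict_of_punctured (L := L) hΩ ?_ ?_
    · filter_upwards [hk] with x hx hxI
      have h1 : (φ x ^ (-a) : ℝ) * φ x ^ a = 1 := by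
        rw [← Real.rpow_add (hφ.pos hxI), neg_add_cancel, Real.rpow_zero]
      have h1' : ((φ x ^ (-a) : ℝ) : ℂ) * ((φ x ^ a : ℝ) : ℂ) = 1 := by exact_mod_cast h1
      have h2 : conj (u x) = k * ((φ x ^ a : ℝ) : ℂ) := by
        rw [← hx hxI, mul_assoc, h1', mul_one]
      rw [powIndicator_of_mem hxI, ← Complex.conj_conj (u x), h2]
      simp
    · filter_upwards [hout] with x hx hxO
      rw [hx hxO, powIndicator_of_notMem fun h => hxO.2 (Ioo_subset_Icc_self h)]
      simp
  filter_upwards [key, hv, Lp.coeFn_smul (conj k) v] with x h1 h2 h3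
  rw [h1, h3, Pi.smul_apply, h2, smul_eq_mul]

/-- In the limit-point case the range of `D' D` is dense. -/
lemma eq_zero_of_inner_factorAdj_factor (hp : 2 < p) (hω : 0 < ω) (hΩ : IsOpen Ω)
    (hI : Ioo (-L) L ⊆ Ω) {a c : ℝ} (ha : a ≤ -1) (hc : c ≠ 0) {u : L2 Ω}
    (hu : ∀ h : testSpace (punctured L Ω), inner ℂ u (embed (punctured L Ω) Ω
      (hφ.factorAdj hp hΩ a c (hφ.factor hp hΩ a c h))) = 0) : u = 0 := by
  have hL := hφ.L_pos
  have hc' : (c : ℂ) ≠ 0 := by exact_mod_cast hc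
  have hout := hφ.ae_eq_zero_outside hΩ (u := u) fun g hg => by
    have := hu g
    rw [hφ.factor_eq_smul hp hΩ a c hg, map_smul, hφ.factorAdj_eq_smul hp hΩ a c hg, map_smul,
      map_smul, inner_smul_right, inner_smul_right, mul_eq_zero, mul_eq_zero] at this
    exact (this.resolve_left hc').resolve_left hc'
  -- Since a ≤ -1 the exponent is nonnegative, so the primitive G of this weight is continuous up to
  -- ± L.
  have hρc : Continuous fun x => φ x ^ (-2 * a - 2) :=
    hφ.continuous.rpow_const fun _ => Or.inr (by linarith)
  obtain ⟨k, d, hkd⟩ := ae_eq_of_integral_deriv_mul_deriv (by linarith : -L < L)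
    (hφ.locallyIntegrableOn_conj_mul_pow hp hI u (-a))
    (ρ := fun x => φ x ^ (-2 * a - 2)) (G := fun x => ∫ t in (0 : ℝ)..x, φ t ^ (-2 * a - 2))
    (hφ.contDiffOn_pow hp _) (fun x hx => Real.rpow_pos_of_pos (hφ.pos hx) _)
    (fun x _ => (hρc.integral_hasStrictDerivAt 0 x).hasDerivAt) fun k hk => by
      have hinv : ∀ x ∈ Ioo (-L) L, (((φ x ^ (-2 * a - 2) : ℝ) : ℂ))⁻¹
          = ((φ x ^ (2 * a + 2) : ℝ) : ℂ) := fun x hx => by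
        rw [← Complex.ofReal_inv, ← Real.rpow_neg (hφ.pos hx).le]
        ring_nf
      have hl : IsTest (Ioo (-L) L)
          fun y => (((φ y ^ (-2 * a - 2) : ℝ) : ℂ))⁻¹ * deriv k y := by
        refine hk.hasTestDeriv.mul_left isOpen_Ioo ?_
        exact (contDiffOn_ofReal (hφ.contDiffOn_pow hp (2 * a + 2))).congr hinv
      -- With g = φ^a k one gets D g = φ^(a+1) k' = φ^(-a-1) l for l = φ^(2a+2) k', the form
      -- required by the substitution for D'.
      have ht : IsTest (Ioo (-L) L) fun x => ((φ x ^ a : ℝ) : ℂ) * k x :=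
        hk.real_mul isOpen_Ioo (hφ.contDiffOn_pow hp _)
      set g : testSpace (punctured L Ω) := ⟨_, ht.mono (Ioo_subset_punctured hI)⟩ with hg
      have := hφ.inner_factorAdj_substitution hp hΩ a c u hl
        (h := hφ.factor hp hΩ a c g) (fun x hx => by
          have hd : deriv g.1 x = ((a * deriv φ x * φ x ^ (a - 1) : ℝ) : ℂ) * k x
              + ((φ x ^ a : ℝ) : ℂ) * deriv k x :=
            ((hφ.hasDerivAt_pow a hx).ofReal_comp.mul (hk.differentiable x).hasDerivAt).deriv
          have hg' : g.1 x = ((φ x ^ a : ℝ) : ℂ) * k x := rfl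
          have h1 : φ x ^ (-a - 1) * φ x ^ (2 * a + 2) = φ x * φ x ^ a := by
            rw [← Real.rpow_add (hφ.pos hx), mul_comm (φ x), ← Real.rpow_add_one (hφ.pos hx).ne']
            ring_nf
          have h1' : ((φ x ^ (-a - 1) : ℝ) : ℂ) * ((φ x ^ (2 * a + 2) : ℝ) : ℂ)
              = φ x * ((φ x ^ a : ℝ) : ℂ) := by exact_mod_cast h1
          rw [hφ.factor_apply_of_mem hp hΩ a c g hx, hd, hg', hinv x hx, ← mul_assoc ((φ x ^ (-a - 1) : ℝ) : ℂ), h1',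
            ← hφ.mul_pow_sub_one a hx]
          push_cast
          ring) fun x hx => by
            simp only [factor, firstOrder, LinearMap.coe_mk, AddHom.coe_mk]
            have h1 : deriv g.1 x = 0 := ht.hasTestDeriv.eq_zero hx
            have h2 : g.1 x = 0 := ht.eq_zero hx
            rw [h1, h2]
            simp
      rw [hu, eq_comm, neg_eq_zero] at this
      exact this
  set B : ℝ → ℂ := fun x =>
    conj (k + d * ((∫ t in (0 : ℝ)..x, φ t ^ (-2 * a - 2) : ℝ) : ℂ)) with hBdef
  have hBc : Continuous B := by
    have : Continuous fun x => ∫ t in (0 : ℝ)..x, φ t ^ (-2 * a - 2) :=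
      intervalIntegral.continuous_primitive (fun _ _ => hρc.intervalIntegrable _ _) 0
    exact Complex.continuous_conj.comp
      (continuous_const.add (continuous_const.mul (Complex.continuous_ofReal.comp this)))
  have huB : ∀ᵐ x, x ∈ Ioo (-L) L → u x = B x * (φ x ^ a : ℝ) := by
    filter_upwards [hkd] with x hx hxI
    have h1 : (φ x ^ (-a) : ℝ) * φ x ^ a = 1 := by
      rw [← Real.rpow_add (hφ.pos hxI), neg_add_cancel, Real.rpow_zero]
    have h1' : ((φ x ^ (-a) : ℝ) : ℂ) * ((φ x ^ a : ℝ) : ℂ) = 1 := by exact_mod_cast h1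
    have h2 : conj (u x) = conj (B x) * ((φ x ^ a : ℝ) : ℂ) := by
      simp only [hBdef, Complex.conj_conj]
      rw [← hx hxI, mul_assoc, h1', mul_one]
    rw [← Complex.conj_conj (u x), h2, map_mul, Complex.conj_conj, Complex.conj_ofReal]
  have hi : IntegrableOn (fun x => ‖u x‖ ^ 2) (Ioo (-L) L) := by
    have h1 : Integrable (fun x => ‖u x‖ ^ 2) (volume.restrict Ω) :=
      (Lp.memLp u).integrable_norm_pow (by norm_num)
    exact IntegrableOn.mono_set (s := Ioo (-L) L) (t := Ω) h1 hI
  have hBL := hφ.eq_zero_of_ae_eq_mul_pow hp hω (by linarith) (Or.inl rfl) hBc.continuousAt huB hi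
  have hBL' := hφ.eq_zero_of_ae_eq_mul_pow hp hω (by linarith) (Or.inr rfl) hBc.continuousAt huB hi
  simp only [hBdef, map_eq_zero] at hBL hBL'
  -- k + d G vanishes at both endpoints while G(L) > G(-L), so d = 0 and then k = 0.
  have hGpos : 0 < ∫ t in (-L)..L, φ t ^ (-2 * a - 2) :=
    intervalIntegral.intervalIntegral_pos_of_pos_on (hρc.intervalIntegrable _ _)
      (fun x hx => Real.rpow_pos_of_pos (hφ.pos hx) _) (by linarith)
  have hG : (∫ t in (-L)..L, φ t ^ (-2 * a - 2)) = (∫ t in (0 : ℝ)..L, φ t ^ (-2 * a - 2))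
      - ∫ t in (0 : ℝ)..(-L), φ t ^ (-2 * a - 2) :=
    (intervalIntegral.integral_interval_sub_left (hρc.intervalIntegrable _ _)
      (hρc.intervalIntegrable _ _)).symm
  have hd0 : d = 0 := by
    have h1 : d * ((∫ t in (-L)..L, φ t ^ (-2 * a - 2) : ℝ) : ℂ) = 0 := by
      rw [hG]
      push_cast
      linear_combination hBL - hBL'
    exact (mul_eq_zero.1 h1).resolve_right (by exact_mod_cast hGpos.ne')
  have hk0 : k = 0 := by rw [hd0, zero_mul, add_zero] at hBL; exact hBL
  rw [Lp.eq_zero_iff_ae_eq_zero]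
  refine ae_restrict_of_punctured (L := L) hΩ ?_ hout
  filter_upwards [huB] with x hx hxI
  rw [hx hxI]
  simp [hBdef, hd0, hk0]

end IsCompacton

end Compacton

/-! ### The core property and the spectra of H₋ and H₊. -/

namespace Compacton

open Set Filter Topology

lemma finrank_eigenspace_of_span {E : Type*} [NormedAddCommGroup E] [InnerProductSpace ℂ E]
    {A : E →ₗ.[ℂ] E} {z : ℂ} {v : E} (h : eigenspace A z = Submodule.span ℂ {v}) (hv : v ≠ 0) :
    Module.finrank ℂ (eigenspace A z) = 1 := by
  rw [h, finrank_span_singleton hv]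

/-- Taking the formal adjoint is an involution: the operator with coefficients (s, r) is the adjoint
of the one with coefficients (-s, r - s'). -/
lemma inner_firstOrder {U Ω : Set ℝ} (hU : IsOpen U) (hUΩ : U ⊆ Ω) {s r : ℝ → ℝ}
    (hs : ContDiffOn ℝ (⊤ : ℕ∞) s U) (hr : ContDiffOn ℝ (⊤ : ℕ∞) r U) {u : L2 Ω} {e : ℝ → ℂ}
    (hu : u =ᵐ[volume.restrict Ω] e) (he : ContDiffOn ℝ (⊤ : ℕ∞) e U) {v : L2 Ω} {k : ℝ → ℂ}
    (hv : v =ᵐ[volume.restrict Ω] k)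
    (hek : ∀ x ∈ U, -(s x * deriv e x) + (r x - deriv s x : ℝ) * e x = k x)
    (h : testSpace U) :
    inner ℂ u (embed U Ω (firstOrder hU hs hr h)) = inner ℂ v (embed U Ω h) := by
  have hs' := contDiffOn_deriv_of_isOpen hU hs
  have e1 : firstOrder hU hs hr h
      = firstOrderAdj hU (s := fun x => -s x) (r := fun x => r x - deriv s x) hs.neg
        (hr.sub hs') h := by
    ext x
    have : deriv (fun x => -s x) x = -deriv s x := deriv.fun_neg
    simp only [firstOrderAdj, firstOrder, LinearMap.coe_mk, AddHom.coe_mk, this]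
    push_cast
    ring
  rw [e1]
  refine inner_firstOrderAdj hU hUΩ _ _ hu he hv (fun x hx => ?_) h
  rw [← hek x hx]
  push_cast
  ring

namespace IsCompacton

variable {p ω L : ℝ} {φ : ℝ → ℝ} {Ω : Set ℝ} (hφ : IsCompacton p ω L φ)
include hφ

/-- The operator `D' D - m` on test functions, with `D` the factor of exponent `a`. -/
noncomputable def testOperator (hp : 2 < p) (hΩ : IsOpen Ω) (a m : ℝ) :
    testSpace (punctured L Ω) →ₗ[ℂ] testSpace (punctured L Ω) :=
  hφ.factorAdj hp hΩ a (Real.sqrt (ω + m)) ∘ₗ hφ.factor hp hΩ a (Real.sqrt (ω + m))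
    - (m : ℂ) • LinearMap.id

/-- Test functions supported away from `± L` form a core of every self-adjoint extension. -/
theorem coreData (hp : 2 < p) (hω : 0 < ω) (hΩ : IsOpen Ω) (hI : Ioo (-L) L ⊆ Ω)
    {a m b l α β : ℝ} {V : ℝ → ℝ}
    (hV : ∀ x ∈ Ioo (-L) L, V x = α + β * φ x ^ (p - 2)) (hV' : ∀ x ∉ Icc (-L) L, V x = ω)
    (hα : a * (a + 1) * ω - m = α) (hβ : -((a + 1) * (2 * a + p - 2) / p) = β)
    (hα' : b * (b + 1) * ω - l = α) (hβ' : -((b + 1) * (2 * b + p - 2) / p) = β)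
    (hm : 0 ≤ m) (hml : m < l) (hb : b ≤ -1) {A : L2 Ω →ₗ.[ℂ] L2 Ω}
    (hA : IsSelfAdjointExtension φ V Ω A) :
    CoreData (embed (punctured L Ω) Ω) (hφ.testOperator hp hΩ a m) A := by
  have hc : Real.sqrt (ω + m) ^ 2 = ω + m := Real.sq_sqrt (by linarith)
  have hc' : Real.sqrt (ω + l) ^ 2 = ω + l := Real.sq_sqrt (by linarith)
  refine coreData_of_dense hA.1 (fun f => hA.2 (hφ.mem_symmGraph hp hΩ hV hV' hα hβ hc f))
    (b := l) (sub_pos.2 hml) (fun f => ?_) fun u hu => ?_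
  -- The two factorizations share the work: exponent a gives the lower bound H + l = D_a' D_a + (l -
  -- m) ≥ l - m, while exponent b gives H + l = D_b' D_b, whose range is dense.
  · have e1 : hφ.testOperator hp hΩ a m f + (l : ℂ) • f
        = hφ.factorAdj hp hΩ a (Real.sqrt (ω + m)) (hφ.factor hp hΩ a (Real.sqrt (ω + m)) f)
          + ((l - m : ℝ) : ℂ) • f := by
      simp only [testOperator, LinearMap.sub_apply, LinearMap.comp_apply, LinearMap.smul_apply,
        LinearMap.id_apply, Complex.ofReal_sub]
      module
    rw [e1, map_add, map_smul, inner_add_right, inner_smul_right, Complex.add_re,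
      (hφ.formalAdjointOn_factor hp hΩ a _).inner_self, inner_self_eq_norm_sq_to_K]
    simp only [← Complex.ofReal_pow, Complex.coe_algebraMap, ← Complex.ofReal_mul,
      Complex.ofReal_re]
    exact le_add_of_nonneg_left (by positivity)
  · refine hφ.eq_zero_of_inner_factorAdj_factor hp hω hΩ hI hb
      (c := Real.sqrt (ω + l)) (Real.sqrt_pos.2 (by linarith)).ne' fun f => ?_
    rw [← hu f]
    congr 2
    have := hφ.factorAdj_factor_eq hp hΩ hV hV' hα hβ hc hα' hβ' hc' f
    rw [← sub_eq_iff_eq_add]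
    exact this.symm

lemma memLp_deriv (hp : 2 < p) :
    MemLp (fun x => ((deriv φ x : ℝ) : ℂ)) 2 (volume.restrict Ω) := by
  have hm : AEStronglyMeasurable (fun x => ((deriv φ x : ℝ) : ℂ)) volume :=
    (Complex.measurable_ofReal.comp (measurable_deriv φ)).aestronglyMeasurable
  have h1 : MemLp (indicator (Ioo (-L) L) fun x => ((deriv φ x : ℝ) : ℂ)) 2 volume := by
    rw [memLp_indicator_iff_restrict measurableSet_Ioo]
    refine MemLp.of_bound hm.restrict (Real.sqrt ω) ?_
    rw [ae_restrict_iff' measurableSet_Ioo]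
    refine Eventually.of_forall fun x hx => ?_
    rw [Complex.norm_real]
    exact hφ.abs_deriv_le hp hx
  refine (h1.restrict Ω).ae_eq (ae_restrict_of_ae ?_)
  have h3 : ∀ᵐ x : ℝ, x ∉ ({-L, L} : Set ℝ) :=
    (toFinite ({-L, L} : Set ℝ)).countable.ae_notMem _
  filter_upwards [h3] with x hx
  by_cases hxI : x ∈ Ioo (-L) L
  · rw [indicator_of_mem hxI]
  · rw [indicator_of_notMem hxI, hφ.deriv_eq_zero
      (notMem_Icc_of_mem_punctured (Ω := univ) ⟨trivial, hx⟩ hxI), Complex.ofReal_zero]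

lemma contDiffOn_deriv_punctured (hp : 2 < p) (hΩ : IsOpen Ω) :
    ContDiffOn ℝ (⊤ : ℕ∞) (fun x => ((deriv φ x : ℝ) : ℂ)) (punctured L Ω) :=
  contDiffOn_ofReal (contDiffOn_deriv_of_isOpen (isOpen_punctured hΩ)
    (hφ.contDiffOn_puncturedSet hp))

/-- The ground-state factor of `H₊` maps `φ'` to a constant on `(-L, L)`. -/
lemma inner_deriv_factorAdj (hp : 2 < p) (hΩ : IsOpen Ω) {c : ℝ} {y k : L2 Ω}
    (hy : y =ᵐ[volume.restrict Ω] fun x => ((deriv φ x : ℝ) : ℂ))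
    (hk : k =ᵐ[volume.restrict Ω] fun x => (powIndicator L φ 0 x : ℂ))
    (h : testSpace (punctured L Ω)) :
    inner ℂ y (embed (punctured L Ω) Ω (hφ.factorAdj hp hΩ ((p - 2) / 2) c h))
      = ((-((p - 2) * ω / 2) : ℝ) : ℂ) * inner ℂ k (embed (punctured L Ω) Ω h) := by
  have hp0 : p ≠ 0 := by linarith
  set z : ℝ := -((p - 2) * ω / 2) with hz
  have hkz : (z : ℂ) • k =ᵐ[volume.restrict Ω] fun x => (z : ℂ) * (powIndicator L φ 0 x : ℂ) := by
    filter_upwards [hk, Lp.coeFn_smul (z : ℂ) k] with x h1 h2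
    rw [h2, Pi.smul_apply, h1, smul_eq_mul]
  have := inner_firstOrderAdj (isOpen_punctured hΩ) punctured_subset
    (hφ.contDiffOn_puncturedSet hp) (hφ.contDiffOn_factorCoeff hp ((p - 2) / 2) c) hy
    (hφ.contDiffOn_deriv_punctured hp hΩ) hkz (fun x hx => ?_) h
  · rw [factorAdj, this, inner_smul_left, Complex.conj_ofReal]
  · by_cases hxI : x ∈ Ioo (-L) L
    · have hd : deriv (fun x => ((deriv φ x : ℝ) : ℂ)) x = ((deriv (deriv φ) x : ℝ) : ℂ) :=
        (hφ.hasDerivAt_deriv hxI).ofReal_comp.deriv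
      rw [hd, factorCoeff_of_mem hxI, powIndicator_of_mem hxI, Real.rpow_zero]
      norm_cast
      have h1 := hφ.sq_deriv hp hxI
      have h2 := hφ.mul_deriv_deriv hp hxI
      rw [h2, hz]
      field_simp at h1 ⊢
      linear_combination -(p - 2) * h1
    · have hx' := notMem_Icc_of_mem_punctured hx hxI
      rw [hφ.eq_zero hxI, hφ.deriv_eq_zero hx', powIndicator_of_notMem hxI]
      simp

/-- In D' = -φ ∂ - (a+1) φ' the derivative kills the constant on (-L, L), leaving a multiple of φ'.
-/
lemma inner_const_factor (hp : 2 < p) (hΩ : IsOpen Ω) {a c : ℝ} {y k : L2 Ω}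
    (hy : y =ᵐ[volume.restrict Ω] fun x => ((deriv φ x : ℝ) : ℂ))
    (hk : k =ᵐ[volume.restrict Ω] fun x => (powIndicator L φ 0 x : ℂ))
    (h : testSpace (punctured L Ω)) :
    inner ℂ k (embed (punctured L Ω) Ω (hφ.factor hp hΩ a c h))
      = ((-(a + 1) : ℝ) : ℂ) * inner ℂ y (embed (punctured L Ω) Ω h) := by
  set z : ℝ := -(a + 1) with hz
  have hyz : (z : ℂ) • y =ᵐ[volume.restrict Ω] fun x => (z : ℂ) * ((deriv φ x : ℝ) : ℂ) := by
    filter_upwards [hy, Lp.coeFn_smul (z : ℂ) y] with x h1 h2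
    rw [h2, Pi.smul_apply, h1, smul_eq_mul]
  have := inner_firstOrder (isOpen_punctured hΩ) punctured_subset
    (hφ.contDiffOn_puncturedSet hp) (hφ.contDiffOn_factorCoeff hp a c) hk
    (contDiffOn_ofReal (hφ.contDiffOn_powIndicator hp 0)) hyz (fun x hx => ?_) h
  · rw [factor, this, inner_smul_left, Complex.conj_ofReal]
  · by_cases hxI : x ∈ Ioo (-L) L
    · rw [hφ.deriv_powIndicator hxI, factorCoeff_of_mem hxI, powIndicator_of_mem hxI,
        Real.rpow_zero, hz]
      push_cast
      ring
    · have hx' := notMem_Icc_of_mem_punctured hx hxI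
      rw [hφ.eq_zero hxI, hφ.deriv_eq_zero hx', powIndicator_of_notMem hxI]
      simp

/-- The spectral properties of `H₋`. -/
theorem spectrum_minus (hp : 2 < p) (hω : 0 < ω) (hΩ : IsOpen Ω) (hI : Ioo (-L) L ⊆ Ω)
    {A : L2 Ω →ₗ.[ℂ] L2 Ω} (hA : IsSelfAdjointExtension φ (potMinus p ω φ) Ω A) :
    IsNonneg A ∧
      ∃ h : MemLp (fun x => (φ x : ℂ)) 2 (volume.restrict Ω),
        eigenspace A 0 = Submodule.span ℂ {h.toLp} ∧
        Module.finrank ℂ (eigenspace A 0) = 1 ∧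
        ∀ u : A.domain, inner ℂ h.toLp (u : L2 Ω) = 0 → u ≠ 0 →
          0 < (inner ℂ (u : L2 Ω) (A u)).re := by
  have hp0 : p ≠ 0 := by linarith
  -- Here 1 and -(p+2)/2 are the two roots of (a+1)(2a+p-2) = 2p, and l = b(b+1) ω - 2ω.
  have hC := hφ.coreData hp hω hΩ hI (a := 1) (m := 0) (b := -(p + 2) / 2)
    (l := ω * (p + 4) * (p - 2) / 4) (α := 2 * ω) (β := -2)
    (fun x hx => by rw [hφ.potMinus_eq hx]; ring) (fun x hx => hφ.potMinus_eq_of_notMem hp hx)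
    (by ring) (by field_simp; ring) (by ring) (by field_simp; ring) le_rfl
    (by have : 0 < p - 2 := by linarith
        positivity) (by linarith) hA
  set c := Real.sqrt (ω + 0) with hc
  have hc0 : c ≠ 0 := (Real.sqrt_pos.2 (by linarith)).ne'
  have hD := hφ.formalAdjointOn_factor hp hΩ 1 c
  have hH : ∀ f, hφ.testOperator hp hΩ 1 0 f
      = hφ.factorAdj hp hΩ 1 c (hφ.factor hp hΩ 1 c f) - ((0 : ℝ) : ℂ) • f := fun f => rfl
  have e1 : (fun x => (φ x : ℂ)) = fun x => (powIndicator L φ 1 x : ℂ) := by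
    ext x
    by_cases hx : x ∈ Ioo (-L) L
    · rw [powIndicator_of_mem hx, Real.rpow_one]
    · rw [powIndicator_of_notMem hx, hφ.eq_zero hx]
  have hmem : MemLp (fun x => (φ x : ℂ)) 2 (volume.restrict Ω) := by
    rw [e1]
    exact hφ.memLp_powIndicator zero_le_one
  have hv : hmem.toLp =ᵐ[volume.restrict Ω] fun x => (powIndicator L φ 1 x : ℂ) := by
    rw [← e1]
    exact hmem.coeFn_toLp
  have hker := fun u => hφ.mem_span_of_inner_factorAdj hp hΩ hI (a := 1) hc0 hv (u := u)
  have hspan := hC.eigenspace_ground hD hH (hφ.inner_powIndicator_factorAdj hp hΩ hv) hker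
  rw [neg_zero, Complex.ofReal_zero] at hspan
  refine ⟨fun u => ?_, hmem, hspan, finrank_eigenspace_of_span hspan
    (hφ.ne_zero_of_ae_eq_powIndicator hI hp hv), fun u hu hu0 => ?_⟩
  · have := hC.form_nonneg hD hH (A.mem_graph u)
    simpa using this
  · have := hC.form_pos_of_inner_eq_zero hD hH hker (A.mem_graph u) (by simpa using hu0) hu
    simpa using this

/-- The spectral properties of `H₊`. -/
theorem spectrum_plus (hp : 2 < p) (hω : 0 < ω) (hΩ : IsOpen Ω) (hI : Ioo (-L) L ⊆ Ω)
    {A : L2 Ω →ₗ.[ℂ] L2 Ω} (hA : IsSelfAdjointExtension φ (potPlus p ω φ) Ω A) :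
    (∃ μ : ℝ, μ < 0 ∧ Module.finrank ℂ (eigenspace A (μ : ℂ)) = 1 ∧
      ∀ ν : ℝ, eigenspace A (ν : ℂ) ≠ ⊥ → ν ≠ μ → 0 ≤ ν) ∧
    negIndex A = 1 ∧
    ∃ h : MemLp (fun x => ((deriv φ x : ℝ) : ℂ)) 2 (volume.restrict Ω),
      eigenspace A 0 = Submodule.span ℂ {h.toLp} ∧
      Module.finrank ℂ (eigenspace A 0) = 1 := by
  have hp0 : p ≠ 0 := by linarith
  have hp2 : 0 < p - 2 := by linarith
  have hp1 : 0 < p := by linarith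
  set m := ω * p * (p - 2) / 4 with hm
  have hm0 : 0 < m := by positivity
  -- Here (p-2)/2 and 1-p are the two roots of (a+1)(2a+p-2) = p(p-2); as α = 0, the shifts are
  -- a(a+1) ω and b(b+1) ω.
  have hC := hφ.coreData hp hω hΩ hI (a := (p - 2) / 2) (m := m) (b := 1 - p)
    (l := (p - 1) * (p - 2) * ω) (α := 0) (β := -(p - 2))
    (fun x hx => by rw [hφ.potPlus_eq hx]; ring) (fun x hx => hφ.potPlus_eq_of_notMem hp hx)
    (by rw [hm]; ring) (by field_simp; ring) (by ring) (by field_simp; ring) hm0.le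
    (by
      have : 0 < ω * (p - 2) * (3 * p - 4) := by
        have : 0 < 3 * p - 4 := by linarith
        positivity
      rw [hm]
      nlinarith) (by linarith) hA
  set c := Real.sqrt (ω + m) with hc
  have hc0 : c ≠ 0 := (Real.sqrt_pos.2 (by linarith)).ne'
  have hk0 : Real.sqrt ω ≠ 0 := (Real.sqrt_pos.2 hω).ne'
  have hD := hφ.formalAdjointOn_factor hp hΩ ((p - 2) / 2) c
  have hK := hφ.formalAdjointOn_factor hp hΩ 0 (Real.sqrt ω)
  have hH : ∀ f, hφ.testOperator hp hΩ ((p - 2) / 2) m f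
      = hφ.factorAdj hp hΩ ((p - 2) / 2) c (hφ.factor hp hΩ ((p - 2) / 2) c f) - (m : ℂ) • f :=
    fun f => rfl
  have hDK := hφ.factor_factorAdj_eq hp hΩ hm (c := c) (Real.sq_sqrt (by linarith))
    (Real.sq_sqrt hω.le)
  have hme := hφ.memLp_powIndicator (Ω := Ω) (a := (p - 2) / 2) (by linarith)
  -- Exponent 0 is the indicator of (-L, L), which spans the kernel of K.
  have hmk := hφ.memLp_powIndicator (Ω := Ω) (a := 0) le_rfl
  have hmy := hφ.memLp_deriv (Ω := Ω) hp
  have he := hφ.inner_powIndicator_factorAdj hp hΩ (c := c) hme.coeFn_toLp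
  have hker := fun u => hφ.mem_span_of_inner_factorAdj hp hΩ hI hc0 hme.coeFn_toLp (u := u)
  have hkerK := fun u => hφ.mem_span_of_inner_factorAdj hp hΩ hI hk0 hmk.coeFn_toLp (u := u)
  have he0 := hφ.ne_zero_of_ae_eq_powIndicator hI hp hme.coeFn_toLp
  have hk0' := hφ.ne_zero_of_ae_eq_powIndicator hI hp hmk.coeFn_toLp
  have hy := hφ.inner_deriv_factorAdj hp hΩ (c := c) hmy.coeFn_toLp hmk.coeFn_toLp
  have hk := hφ.inner_const_factor hp hΩ (a := (p - 2) / 2) (c := c) hmy.coeFn_toLp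
    hmk.coeFn_toLp
  have hgr := hC.ground_mem_graph hH he
  have hgap : ∀ x x', (x, x') ∈ A.graph → inner ℂ hme.toLp x = 0 → 0 ≤ (inner ℂ x x').re :=
    fun x x' hx hex => hC.form_nonneg_of_inner_eq_zero hD hH hK hDK hm0 hker hx hex
  -- The constants are c₀ = -(p-2) ω/2 from D φ' and c₁ = -p/2 from D' applied to the indicator;
  -- their product is m.
  have hzero := hC.eigenspace_zero_of_gap hD hH hK hDK hm0 he hker hkerK hy hk (by
    rw [hm]
    push_cast
    ring)
  -- If φ' vanished, `hy` would make the indicator of (-L, L) orthogonal to all test functions.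
  have hy0 : hmy.toLp ≠ 0 := by
    intro h0
    obtain ⟨g, hg, hg1⟩ := exists_isTest_integral_ne_zero (by linarith [hφ.L_pos] : -L < L)
      (hφ.contDiffOn_pow hp 0).continuousOn fun x hx => Real.rpow_pos_of_pos (hφ.pos hx) 0
    have h1 := hy ⟨g, hg.mono (Ioo_subset_punctured hI)⟩
    rw [h0, inner_zero_left, eq_comm, mul_eq_zero] at h1
    have h2 := h1.resolve_left (by
      have : (-((p - 2) * ω / 2)) ≠ 0 := neg_ne_zero.2 (by positivity)
      exact_mod_cast this)
    rw [inner_embed punctured_subset hmk.coeFn_toLp] at h2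
    refine one_ne_zero (hg1.symm.trans (Eq.trans ?_ h2))
    refine integral_congr_ae (Eventually.of_forall fun x => ?_)
    by_cases hx : x ∈ Ioo (-L) L
    · simp only [powIndicator_of_mem hx, Complex.conj_ofReal]
    · simp only [hg.eq_zero hx, mul_zero]
  refine ⟨⟨-m, neg_lt_zero.2 hm0, finrank_eigenspace_of_span (hC.eigenspace_ground hD hH he hker)
    he0, fun ν hν hne => eigenvalue_nonneg_of_gap hA.1 hgr hgap hν hne⟩,
    negIndex_eq_one_of_gap (neg_lt_zero.2 hm0) he0 hgr hgap, hmy, hzero,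
    finrank_eigenspace_of_span hzero hy0⟩

end IsCompacton

end Compacton

theorem proposition8 (p ω L : ℝ) (hp : 2 < p) (hω : 0 < ω) (φ : ℝ → ℝ)
    (hφ : Compacton.IsCompacton p ω L φ)
    (Ω : Set ℝ) (hΩ : Ω = Set.univ ∨ Ω = Set.Ioo (-L) L) :
    (∀ A : Compacton.L2 Ω →ₗ.[ℂ] Compacton.L2 Ω,
      Compacton.IsSelfAdjointExtension φ (Compacton.potMinus p ω φ) Ω A →
        Compacton.IsNonneg A ∧
        ∃ h : MemLp (fun x => (φ x : ℂ)) 2 (volume.restrict Ω),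
          Compacton.eigenspace A 0 = Submodule.span ℂ {h.toLp} ∧
          Module.finrank ℂ (Compacton.eigenspace A 0) = 1 ∧
          ∀ u : A.domain, inner ℂ h.toLp (u : Compacton.L2 Ω) = 0 → u ≠ 0 →
            0 < (inner ℂ (u : Compacton.L2 Ω) (A u)).re) ∧
    (∀ A : Compacton.L2 Ω →ₗ.[ℂ] Compacton.L2 Ω,
      Compacton.IsSelfAdjointExtension φ (Compacton.potPlus p ω φ) Ω A →
        (∃ μ : ℝ, μ < 0 ∧
          Module.finrank ℂ (Compacton.eigenspace A (μ : ℂ)) = 1 ∧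
          ∀ ν : ℝ, Compacton.eigenspace A (ν : ℂ) ≠ ⊥ → ν ≠ μ → 0 ≤ ν) ∧
        Compacton.negIndex A = 1 ∧
        ∃ h : MemLp (fun x => ((deriv φ x : ℝ) : ℂ)) 2 (volume.restrict Ω),
          Compacton.eigenspace A 0 = Submodule.span ℂ {h.toLp} ∧
          Module.finrank ℂ (Compacton.eigenspace A 0) = 1) := by
  have hI : Set.Ioo (-L) L ⊆ Ω := by
    rcases hΩ with rfl | rfl
    · exact Set.subset_univ _
    · exact subset_rfl
  have hΩo : IsOpen Ω := by
    rcases hΩ with rfl | rfl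
    · exact isOpen_univ
    · exact isOpen_Ioo
  exact ⟨fun A hA => hφ.spectrum_minus hp hω hΩo hI hA,
    fun A hA => hφ.spectrum_plus hp hω hΩo hI hA⟩
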